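/- Let $M$ be a smooth Riemannian manifold of dimension $n\ge 3$ (without boundary), with Levi-Civita connection $\nabla$, and let $\mathrm{C}\ell(M)$ be its Clifford bundle, with the convention $X\cdot X=-|X|^2$ and its natural connection. Let $S$ be a Dirac bundle over $M$ of finite rank: a smooth real vector bundle with a Euclidean metric, a metric connection $\nabla$ and a smooth left $\mathrm{C}\ell(M)$-module structure such that $\langle X\cdot\sigma,\tau\rangle+\langle\sigma,X\cdot\tau\rangle=0$ for $X\in T_pM$, $\sigma,\tau\in S_p$, and $\nabla(a\cdot\sigma)=(\nabla a)\cdot\sigma+a\cdot\nabla\sigma$ for smooth sections $a$ of $\mathrm{C}\ell(M)$ and $\sigma$ of $S$. Let $R(X,Y)=\nabla_X\nabla_Y-\nabla_Y\nabla_X-\nabla_{[X,Y]}$ be the curvature of $S$ and, for an orthonormal frame $e_1,\dots,e_n$ and $X\in TM$, put $$D\sigma=\sum_{i}e_i\cdot\nabla_{e_i}\sigma,\qquad \mathcal R\sigma=\sum_{i<j}e_i\cdot e_j\cdot R(e_i,e_j)\sigma,\qquad \mathrm{Ric}_X\sigma=2\sum_i e_i\cdot R(e_i,X)\sigma,$$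 $$L_X\sigma=X\cdot\sigma,\qquad \mathcal K_X=\frac{n}{n-2}\Big[\frac1{n-1}L_X\circ\mathcal R-\frac12\mathrm{Ric}_X\Big].$$ A smooth section $\sigma$ of $S$ is a twistor section if $\nabla_X\sigma+\frac1n X\cdot D\sigma=0$ for all $X\in TM$. (a) The matrix $\begin{pmatrix}\nabla&\frac1nL\\-\mathcal K&\nabla\end{pmatrix}$, that is, $\nabla^E_X(\sigma,\tau)=\big(\nabla_X\sigma+\tfrac1nX\cdot\tau,\;-\mathcal K_X\sigma+\nabla_X\tau\big)$, defines a smooth connection $\nabla^E$ on $E=S\oplus S$, and a smooth section $\sigma$ of $S$ is a twistor section if and only if the section $(\sigma,D\sigma)$ of $E$ is $\nabla^E$-parallel. (b) If $M$ is connected, then the real vector space of twistor sections of $S$ is finite-dimensional, of dimension at most $2\,\mathrm{rk}\,S$. -/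

import Mathlib

open Bundle Manifold ContDiff Topology

noncomputable section TwistorSections

/-! Throughout, `M` is a smooth manifold modelled on the finite-dimensional real vector space `E`
(so `dim M = finrank ℝ E`), with a smooth Riemannian metric on its tangent bundle, and `S` is a
smooth real vector bundle over `M` with fibre model `F` and a smooth Euclidean metric. -/

variable
  {E : Type*} [NormedAddCommGroup E] [NormedSpace ℝ E] [FiniteDimensional ℝ E]
  {H : Type*} [TopologicalSpace H] {I : ModelWithCorners ℝ E H}
  {M : Type*} [TopologicalSpace M] [ChartedSpace H M] [IsManifold I ∞ M]
  [RiemannianBundle (fun x : M ↦ TangentSpace I x)]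
  [IsContMDiffRiemannianBundle I ∞ E (fun x : M ↦ TangentSpace I x)]

instance tangentSpaceFiniteDimensional (p : M) : FiniteDimensional ℝ (TangentSpace I p) :=
  inferInstanceAs (FiniteDimensional ℝ E)

/-- `nablaM` is (a smooth version of) the Levi-Civita connection: the metric, torsion-free
connection on the tangent bundle. -/
structure IsLeviCivita
    (nablaM : CovariantDerivative I E (fun x : M ↦ TangentSpace I x)) : Prop where
  smooth : CovariantDerivative.ContMDiffCovariantDerivative nablaM ∞
  metric : ∀ (p : M) (Y Z : Π q : M, TangentSpace I q),
    MDiffAt (T% Y) p → MDiffAt (T% Z) p → ∀ x : TangentSpace I p,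
      mvfderiv I (fun q ↦ inner ℝ (Y q) (Z q)) p x =
        inner ℝ (nablaM Y p x) (Z p) + inner ℝ (Y p) (nablaM Z p x)
  torsion_free : nablaM.torsion = 0

/-- The quadratic form `X ↦ -|X|²` on the tangent space at `p`. -/
def cliffordForm (I : ModelWithCorners ℝ E H) [IsManifold I ∞ M]
    [RiemannianBundle (fun x : M ↦ TangentSpace I x)] (p : M) :
    QuadraticForm ℝ (TangentSpace I p) :=
  -LinearMap.BilinMap.toQuadraticMap (innerₗ (TangentSpace I p))

/-- The fibre at `p` of the Clifford bundle `Cℓ(M)`; thus `X * X = -|X|²`. -/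
abbrev CliffordFibre (I : ModelWithCorners ℝ E H) [IsManifold I ∞ M]
    [RiemannianBundle (fun x : M ↦ TangentSpace I x)] (p : M) : Type _ :=
  CliffordAlgebra (cliffordForm I p)

/-- The inclusion `T_p M → Cℓ(M)_p`. -/
abbrev cliffordι (I : ModelWithCorners ℝ E H) [IsManifold I ∞ M]
    [RiemannianBundle (fun x : M ↦ TangentSpace I x)] (p : M) :
    TangentSpace I p →ₗ[ℝ] CliffordFibre I p :=
  CliffordAlgebra.ι (cliffordForm I p)

/-- `CliffordCovDerivAt nablaM p a a'` says that the section `a` of the Clifford bundle is smooth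
at `p` and that its covariant derivative there, for the natural connection of `Cℓ(M)`, is
`x ↦ a' x`. The natural connection is the one that extends the differential on functions and
`nablaM` on vector fields and is a derivation for the Clifford product. Near a point every smooth
section of `Cℓ(M)` is a finite sum of products of smooth functions and smooth vector fields,
so that these rules determine it. -/
inductive CliffordCovDerivAt
    (nablaM : CovariantDerivative I E (fun x : M ↦ TangentSpace I x)) (p : M) :
    (Π q : M, CliffordFibre I q) → (TangentSpace I p → CliffordFibre I p) → Prop
  | scalar {f : M → ℝ} (hf : CMDiffAt ∞ f p) :
      CliffordCovDerivAt nablaM p (fun q ↦ algebraMap ℝ (CliffordFibre I q) (f q))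
        (fun x ↦ algebraMap ℝ (CliffordFibre I p) (mvfderiv I f p x))
  | vector {X : Π q : M, TangentSpace I q} (hX : CMDiffAt ∞ (T% X) p) :
      CliffordCovDerivAt nablaM p (fun q ↦ cliffordι I q (X q))
        (fun x ↦ cliffordι I p (nablaM X p x))
  | add {a b : Π q : M, CliffordFibre I q} {a' b' : TangentSpace I p → CliffordFibre I p}
      (ha : CliffordCovDerivAt nablaM p a a') (hb : CliffordCovDerivAt nablaM p b b') :
      CliffordCovDerivAt nablaM p (fun q ↦ a q + b q) (fun x ↦ a' x + b' x)
  | mul {a b : Π q : M, CliffordFibre I q} {a' b' : TangentSpace I p → CliffordFibre I p}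
      (ha : CliffordCovDerivAt nablaM p a a') (hb : CliffordCovDerivAt nablaM p b b') :
      CliffordCovDerivAt nablaM p (fun q ↦ a q * b q) (fun x ↦ a' x * b p + a p * b' x)
  | congr {a b : Π q : M, CliffordFibre I q} {a' : TangentSpace I p → CliffordFibre I p}
      (ha : CliffordCovDerivAt nablaM p a a') (hab : ∀ᶠ q in 𝓝 p, a q = b q) :
      CliffordCovDerivAt nablaM p b a'

variable
  (F : Type*) [NormedAddCommGroup F] [NormedSpace ℝ F] [FiniteDimensional ℝ F]
  (S : M → Type*) [TopologicalSpace (TotalSpace F S)]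
  [∀ x, NormedAddCommGroup (S x)] [∀ x, InnerProductSpace ℝ (S x)]
  [FiberBundle F S] [VectorBundle ℝ F S] [ContMDiffVectorBundle ∞ F S I]
  [IsContMDiffRiemannianBundle I ∞ F S]

/-- The structure of a Dirac bundle on the Euclidean vector bundle `S`: a smooth left module
structure over the Clifford bundle and a smooth metric connection, such that tangent
vectors act by skew-adjoint maps and such that
`∇(a · σ) = (∇a) · σ + a · ∇σ` for smooth sections `a` of `Cℓ(M)` and `σ` of `S`. -/
structure DiracBundle
    (nablaM : CovariantDerivative I E (fun x : M ↦ TangentSpace I x)) where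
  /-- the action of `Cℓ(M)_p` on `S_p` -/
  action : Π p : M, CliffordFibre I p →ₐ[ℝ] Module.End ℝ (S p)
  /-- the action is smooth -/
  action_smooth : ∀ (p : M) (X : Π q : M, TangentSpace I q) (σ : Π q : M, S q),
    CMDiffAt ∞ (T% X) p → CMDiffAt ∞ (T% σ) p →
      CMDiffAt ∞ (T% (fun q : M ↦ action q (cliffordι I q (X q)) (σ q))) p
  /-- the connection of `S` -/
  nabla : CovariantDerivative I F S
  nabla_smooth : CovariantDerivative.ContMDiffCovariantDerivative nabla ∞
  nabla_metric : nabla.IsMetricCompatible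
  skew : ∀ (p : M) (x : TangentSpace I p) (s t : S p),
    inner ℝ (action p (cliffordι I p x) s) t + inner ℝ s (action p (cliffordι I p x) t) = 0
  leibniz : ∀ (p : M) (a : Π q : M, CliffordFibre I q)
      (a' : TangentSpace I p → CliffordFibre I p) (σ : Π q : M, S q),
    CliffordCovDerivAt nablaM p a a' → CMDiffAt ∞ (T% σ) p →
      ∀ x : TangentSpace I p,
        nabla (fun q ↦ action q (a q) (σ q)) p x
          = action p (a' x) (σ p) + action p (a p) (nabla σ p x)

namespace DiracBundle

variable {F S} {nablaM : CovariantDerivative I E (fun x : M ↦ TangentSpace I x)}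
  (𝒟 : DiracBundle F S nablaM)

/-- Clifford multiplication `L_x : S_p → S_p` by a tangent vector `x`. -/
def cmul (p : M) (x : TangentSpace I p) : S p →ₗ[ℝ] S p :=
  𝒟.action p (cliffordι I p x)

/-- An orthonormal basis of `T_p M`. -/
def onb (I : ModelWithCorners ℝ E H) [IsManifold I ∞ M]
    [RiemannianBundle (fun x : M ↦ TangentSpace I x)] (p : M) :
    OrthonormalBasis (Fin (Module.finrank ℝ (TangentSpace I p))) ℝ (TangentSpace I p) :=
  stdOrthonormalBasis ℝ (TangentSpace I p)

/-- The Dirac operator `D σ = ∑ i, e_i · ∇_{e_i} σ`. -/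
def dirac (σ : Π q : M, S q) : Π q : M, S q :=
  fun p ↦ ∑ i, 𝒟.cmul p (onb I p i) (𝒟.nabla σ p (onb I p i))

/-- The curvature `R(x, y) s` of the connection of `S`, where
`R(X, Y) σ = ∇_X ∇_Y σ - ∇_Y ∇_X σ - ∇_{[X, Y]} σ`. Since this expression is tensorial, it is
evaluated on the extensions of `x`, `y`, `s` that are constant in a local trivialization. -/
def curvature (p : M) (x y : TangentSpace I p) (s : S p) : S p :=
  let X : Π q : M, TangentSpace I q := FiberBundle.extend E x
  let Y : Π q : M, TangentSpace I q := FiberBundle.extend E y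
  let σ : Π q : M, S q := FiberBundle.extend F s
  𝒟.nabla (fun q ↦ 𝒟.nabla σ q (Y q)) p x - 𝒟.nabla (fun q ↦ 𝒟.nabla σ q (X q)) p y
    - 𝒟.nabla σ p (VectorField.mlieBracket I X Y p)

/-- The Weitzenböck curvature operator `∑ i < j, e_i · e_j · R(e_i, e_j) s`. -/
def weitzenboeck (p : M) (s : S p) : S p :=
  ∑ i, ∑ j ∈ Finset.Ioi i,
    𝒟.cmul p (onb I p i) (𝒟.cmul p (onb I p j) (𝒟.curvature p (onb I p i) (onb I p j) s))

/-- The Ricci curvature operator `Ric_x s = 2 ∑ i, e_i · R(e_i, x) s`. -/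
def ricci (p : M) (x : TangentSpace I p) (s : S p) : S p :=
  (2 : ℝ) • ∑ i, 𝒟.cmul p (onb I p i) (𝒟.curvature p (onb I p i) x s)

/-- `K_x s = n / (n - 2) * (1 / (n - 1) * x · 𝓡 s - 1 / 2 * Ric_x s)` with `n = dim M`. -/
def curlyK (p : M) (x : TangentSpace I p) (s : S p) : S p :=
  let n : ℝ := Module.finrank ℝ E
  (n / (n - 2)) •
    ((1 / (n - 1)) • 𝒟.cmul p x (𝒟.weitzenboeck p s) - (1 / 2 : ℝ) • 𝒟.ricci p x s)

/-- The smooth section `σ` is a twistor section: `∇_x σ + (1 / n) x · D σ = 0` for all tangent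
vectors `x`. -/
def IsTwistor (σ : Cₛ^∞⟮I; F, S⟯) : Prop :=
  ∀ (p : M) (x : TangentSpace I p),
    𝒟.nabla σ p x + (1 / (Module.finrank ℝ E : ℝ)) • 𝒟.cmul p x (𝒟.dirac σ p) = 0

/-- The real vector space of twistor sections. -/
def twistorSpace : Submodule ℝ Cₛ^∞⟮I; F, S⟯ where
  carrier := {σ | 𝒟.IsTwistor σ}
  zero_mem' := by
    intro p x
    have h0 : (⇑(0 : Cₛ^∞⟮I; F, S⟯) : Π q : M, S q) = 0 := rfl
    simp [h0, dirac]
  add_mem' := by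
    intro σ τ hσ hτ p x
    have hadd : ∀ q, 𝒟.nabla (⇑(σ + τ)) q = 𝒟.nabla σ q + 𝒟.nabla τ q := fun q ↦
      𝒟.nabla.isCovariantDerivativeOnUniv.add
        (σ.contMDiff.mdifferentiable (by simp) q) (τ.contMDiff.mdifferentiable (by simp) q)
    have hD : 𝒟.dirac (⇑(σ + τ)) p = 𝒟.dirac σ p + 𝒟.dirac τ p := by
      simp only [dirac, hadd, add_apply, map_add, Finset.sum_add_distrib]
    have := congrArg₂ (· + ·) (hσ p x) (hτ p x)
    rw [hadd, hD, map_add, smul_add, add_apply, add_add_add_comm]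
    simpa using this
  smul_mem' := by
    intro c σ hσ p x
    have hsmul : ∀ q, 𝒟.nabla (⇑(c • σ)) q = c • 𝒟.nabla σ q := fun q ↦
      𝒟.nabla.isCovariantDerivativeOnUniv.smul_const c
        (σ.contMDiff.mdifferentiable (by simp) q)
    have hD : 𝒟.dirac (⇑(c • σ)) p = c • 𝒟.dirac σ p := by
      simp only [dirac, hsmul, smul_apply, map_smul, Finset.smul_sum]
    have := congrArg (c • ·) (hσ p x)
    rw [hsmul, hD, map_smul, smul_apply, smul_comm, ← smul_add]
    simpa using this

/-- `nablaE` is the connection on `S ⊕ S` with matrix `((∇, (1 / n) L), (-K, ∇))`, that is,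
`∇ᴱ_x (σ, τ) = (∇_x σ + (1 / n) x · τ, -K_x σ + ∇_x τ)`. -/
def IsTwistorConnection (nablaE : CovariantDerivative I (F × F) (S ×ᵇ S)) : Prop :=
  ∀ (σ τ : Π q : M, S q) (p : M) (x : TangentSpace I p),
    nablaE (fun q ↦ (σ q, τ q)) p x =
      (𝒟.nabla σ p x + (1 / (Module.finrank ℝ E : ℝ)) • 𝒟.cmul p x (τ p),
        -𝒟.curlyK p x (σ p) + 𝒟.nabla τ p x)

end DiracBundle

/-- A section `u` is parallel for the connection `cov` if `∇_x u = 0` for all tangent vectors. -/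
def CovariantDerivative.IsParallel {G : Type*} [NormedAddCommGroup G] [NormedSpace ℝ G]
    {V : M → Type*} [TopologicalSpace (TotalSpace G V)] [∀ x, AddCommGroup (V x)]
    [∀ x, Module ℝ (V x)] [∀ x, TopologicalSpace (V x)] [∀ x, IsTopologicalAddGroup (V x)]
    [∀ x, ContinuousSMul ℝ (V x)] [FiberBundle G V]
    (cov : CovariantDerivative I G V) (u : Π q : M, V q) : Prop :=
  ∀ (p : M) (x : TangentSpace I p), cov u p x = 0

end TwistorSections

/-! Let `σ` be a twistor section, so that ∇_Y σ = -(1/n) Y·Dσ. Differentiating once more, with the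
Leibniz rule for Clifford multiplication and the vanishing torsion, expresses the curvature by first
derivatives of `Dσ` (`curvature_of_isTwistor`): R(x, y)σ = (1/n)(x·∇_y Dσ - y·∇_x Dσ). Contracting
with Clifford products over an orthonormal basis gives 𝓡σ = ((n-1)/n) D²σ and Ric_x σ = (2/n)((2-n)
∇_x Dσ + x·D²σ). Eliminating D²σ, which needs n ≠ 2, leaves ∇_x Dσ = K_x σ
(`nabla_dirac_of_isTwistor`). Together with the twistor equation this says that (σ, Dσ) is parallel
for the matrix connection; conversely, the first component of parallelism is the twistor equation.

For the dimension bound, f = |σ|² + |Dσ|² satisfies |Xf| ≤ C f locally, since the derivatives of σ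
and Dσ are zeroth-order in (σ, Dσ). Grönwall along straight segments in a chart makes the zero set
of f open; it is also closed. On a connected manifold σ is therefore determined by (σ, Dσ) at one
point (`eq_zero_of_isTwistor`), that is, by an element of a space of dimension 2 rk S.

The rest is analytic support: smoothness of D, 𝓡, Ric and K through smooth local orthonormal frames,
and tensoriality of the curvature, which frees it from the particular extensions used in its
definition. -/

set_option linter.unusedSectionVars false

open Bundle Manifold ContDiff Topology

/-! ### Sections smooth near a point, and tensorial operations on them. -/

noncomputable section LocalSections

variable
  {E : Type*} [NormedAddCommGroup E] [NormedSpace ℝ E]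
  {H : Type*} [TopologicalSpace H] {I : ModelWithCorners ℝ E H}
  {M : Type*} [TopologicalSpace M] [ChartedSpace H M] [IsManifold I ∞ M]
  {F : Type*} [NormedAddCommGroup F] [NormedSpace ℝ F]
  {V : M → Type*} [TopologicalSpace (TotalSpace F V)]
  [∀ x, AddCommGroup (V x)] [∀ x, Module ℝ (V x)] [∀ x, TopologicalSpace (V x)]
  [FiberBundle F V]

variable (I F) in
/-- The section `σ` is smooth on a neighbourhood of `p`. -/
def SmoothNear (σ : Π q : M, V q) (p : M) : Prop :=
  ∀ᶠ q in 𝓝 p, CMDiffAt ∞ (T% σ) q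

namespace SmoothNear

variable {σ τ : Π q : M, V q} {p : M}

lemma contMDiffAt (h : SmoothNear I F σ p) : CMDiffAt ∞ (T% σ) p := h.self_of_nhds

lemma mdifferentiableAt (h : SmoothNear I F σ p) : MDiffAt (T% σ) p :=
  h.contMDiffAt.mdifferentiableAt (by simp)

lemma eventually (h : SmoothNear I F σ p) : ∀ᶠ q in 𝓝 p, SmoothNear I F σ q :=
  eventually_eventually_nhds.2 h

lemma of_contMDiff (h : CMDiff ∞ (T% σ)) : SmoothNear I F σ p := .of_forall h

lemma congr (h : SmoothNear I F σ p) (hτ : ∀ᶠ q in 𝓝 p, τ q = σ q) : SmoothNear I F τ p := by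
  filter_upwards [h, eventually_eventually_nhds.2 hτ] with q hq hq'
  exact hq.congr_of_eventuallyEq (hq'.mono fun r hr ↦ by simp [hr])

variable [VectorBundle ℝ F V]

lemma add (hσ : SmoothNear I F σ p) (hτ : SmoothNear I F τ p) : SmoothNear I F (σ + τ) p := by
  filter_upwards [hσ, hτ] with q h h' using h.add_section h'

lemma sub (hσ : SmoothNear I F σ p) (hτ : SmoothNear I F τ p) : SmoothNear I F (σ - τ) p := by
  filter_upwards [hσ, hτ] with q h h' using h.sub_section h'

lemma neg (hσ : SmoothNear I F σ p) : SmoothNear I F (-σ) p := by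
  filter_upwards [hσ] with q h using h.neg_section

lemma const_smul (a : ℝ) (hσ : SmoothNear I F σ p) : SmoothNear I F (a • σ) p := by
  filter_upwards [hσ] with q h using h.const_smul_section

lemma smul {f : M → ℝ} (hf : ∀ᶠ q in 𝓝 p, CMDiffAt ∞ f q) (hσ : SmoothNear I F σ p) :
    SmoothNear I F (f • σ) p := by
  filter_upwards [hf, hσ] with q h h' using h.smul_section h'

lemma sum {ι : Type*} {s : Finset ι} {σ : ι → Π q : M, V q}
    (hσ : ∀ i ∈ s, SmoothNear I F (σ i) p) : SmoothNear I F (fun q ↦ ∑ i ∈ s, σ i q) p := by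
  filter_upwards [(Finset.eventually_all s).2 hσ] with q h using ContMDiffAt.sum_section h

lemma localFrame [ContMDiffVectorBundle ∞ F V I] {ι : Type*} (b : Module.Basis ι ℝ F)
    (i : ι) : SmoothNear I F ((trivializationAt F V p).localFrame b i) p := by
  filter_upwards [(trivializationAt F V p).open_baseSet.mem_nhds
    (FiberBundle.mem_baseSet_trivializationAt F V p)] with q hq
  exact contMDiffAt_localFrame_of_mem ∞ _ b i hq

lemma extend [ContMDiffVectorBundle ∞ F V I] (v : V p) :
    SmoothNear I F (FiberBundle.extend F v) p := by
  obtain ⟨s, hs, h⟩ := FiberBundle.exists_contMDiffOn_extend (k := ∞) I F v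
  obtain ⟨t, hts, ht, hpt⟩ := mem_nhds_iff.1 hs
  filter_upwards [ht.mem_nhds hpt] with q hq
  exact h.contMDiffAt (Filter.mem_of_superset (ht.mem_nhds hq) hts)

lemma localFrameCoeff [FiniteDimensional ℝ F] [ContMDiffVectorBundle ∞ F V I] {ι : Type*}
    (b : Module.Basis ι ℝ F) (hσ : SmoothNear I F σ p) (i : ι) :
    ∀ᶠ q in 𝓝 p, CMDiffAt ∞
      (LinearMap.piApply ((trivializationAt F V p).localFrameCoeff I b i) σ) q := by
  filter_upwards [hσ, (trivializationAt F V p).open_baseSet.mem_nhds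
    (FiberBundle.mem_baseSet_trivializationAt F V p)] with q hσ hq
  exact contMDiffAt_localFrameCoeff b hq hσ i

/-- A section smooth near `p` agrees near `p` with a smooth section. -/
lemma exists_contMDiff_eq [FiniteDimensional ℝ E] [T2Space M]
    (hσ : SmoothNear I F σ p) :
    ∃ σ' : Π q : M, V q, CMDiff ∞ (T% σ') ∧ ∀ᶠ q in 𝓝 p, σ' q = σ q := by
  obtain ⟨u, hu, huo, hpu⟩ := eventually_nhds_iff.1 hσ
  -- A bump function supported where `σ` is smooth: its product with `σ` is smooth everywhere and
  -- equals `σ` where the bump function is 1.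
  obtain ⟨f, -, hf⟩ := (SmoothBumpFunction.nhds_basis_tsupport (I := I) p).mem_iff.1
    (huo.mem_nhds hpu)
  refine ⟨(f : M → ℝ) • σ, ?_, ?_⟩
  · exact ContMDiffOn.smul_section_of_tsupport f.contMDiff.contMDiffOn huo hf
      fun q hq ↦ (hu q hq).contMDiffWithinAt
  · filter_upwards [f.eventuallyEq_one] with q hq
    simp [hq]

end SmoothNear

/-- The operation `Φ` on sections of `V` is additive and homogeneous over functions, for sections
and functions that are smooth near `p`. -/
structure SmoothTensorialAt (I : ModelWithCorners ℝ E H) (F : Type*) [NormedAddCommGroup F]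
    [NormedSpace ℝ F] {V : M → Type*} [TopologicalSpace (TotalSpace F V)]
    [∀ x, AddCommGroup (V x)] [∀ x, Module ℝ (V x)] [∀ x, TopologicalSpace (V x)]
    [FiberBundle F V] {A : Type*} [AddCommGroup A] [Module ℝ A]
    (Φ : (Π q : M, V q) → A) (p : M) : Prop where
  smul : ∀ {f : M → ℝ} {σ : Π q : M, V q}, (∀ᶠ q in 𝓝 p, CMDiffAt ∞ f q) →
    SmoothNear I F σ p → Φ (f • σ) = f p • Φ σ
  add : ∀ {σ σ' : Π q : M, V q}, SmoothNear I F σ p → SmoothNear I F σ' p →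
    Φ (σ + σ') = Φ σ + Φ σ'
  congr : ∀ {σ σ' : Π q : M, V q}, SmoothNear I F σ p → SmoothNear I F σ' p →
    (∀ᶠ q in 𝓝 p, σ q = σ' q) → Φ σ = Φ σ'

namespace SmoothTensorialAt

variable {A : Type*} [AddCommGroup A] [Module ℝ A] {Φ : (Π q : M, V q) → A} {p : M}
  [VectorBundle ℝ F V]

lemma sum (hΦ : SmoothTensorialAt I F Φ p) {ι : Type*} (s : Finset ι) (σ : ι → Π q : M, V q)
    (hσ : ∀ i ∈ s, SmoothNear I F (σ i) p) :
    Φ (fun q ↦ ∑ i ∈ s, σ i q) = ∑ i ∈ s, Φ (σ i) := by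
  classical
  induction s using Finset.induction_on with
  | empty =>
      -- The value on the zero section comes from homogeneity with the zero function.
      have h := hΦ.smul (f := fun _ ↦ 0) (σ := 0) (.of_forall fun _ ↦ contMDiffAt_const)
        (.of_contMDiff ((contMDiff_zeroSection ℝ V).of_le le_top))
      simp only [Finset.sum_empty]
      have h0 : ((fun _ ↦ 0 : M → ℝ) • (0 : Π q : M, V q)) = fun _ ↦ 0 := by ext q; simp
      rw [h0] at h
      simpa using h
  | insert a s ha ih =>
      simp only [Finset.mem_insert, forall_eq_or_imp] at hσ
      simp only [Finset.sum_insert ha, ← ih hσ.2]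
      exact hΦ.add hσ.1 (.sum hσ.2)

variable [FiniteDimensional ℝ F] [ContMDiffVectorBundle ∞ F V I]

/-- A tensorial operation depends only on the value of the section at `p`. -/
lemma pointwise (hΦ : SmoothTensorialAt I F Φ p) {σ σ' : Π q : M, V q}
    (hσ : SmoothNear I F σ p) (hσ' : SmoothNear I F σ' p) (h : σ p = σ' p) : Φ σ = Φ σ' := by
  let t := trivializationAt F V p
  have hp : p ∈ t.baseSet := FiberBundle.mem_baseSet_trivializationAt F V p
  let b := Module.Basis.ofVectorSpace ℝ F
  -- Expanding in a local frame, `Φ` sees only the values at `p` of the coefficients.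
  have key {σ : Π q : M, V q} (hσ : SmoothNear I F σ p) :
      Φ σ = ∑ i, t.localFrameCoeff I b i p (σ p) • Φ (t.localFrame b i) := by
    have hterm (i) : SmoothNear I F
        ((LinearMap.piApply (t.localFrameCoeff I b i) σ) • t.localFrame b i) p :=
      .smul (hσ.localFrameCoeff b i) (.localFrame b i)
    rw [hΦ.congr hσ (SmoothNear.sum (s := Finset.univ) fun i _ ↦ hterm i)
      (t.eventually_eq_localFrame_sum_coeff_smul b hp), hΦ.sum _ _ fun i _ ↦ hterm i]
    exact Finset.sum_congr rfl fun i _ ↦ hΦ.smul (hσ.localFrameCoeff b i) (.localFrame b i)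
  rw [key hσ, key hσ', h]

end SmoothTensorialAt

section Hom

variable [∀ x, IsTopologicalAddGroup (V x)] [∀ x, ContinuousSMul ℝ (V x)] [VectorBundle ℝ F V]

/-- A smooth connection maps sections smooth near `p` to sections smooth near `p`. -/
lemma SmoothNear.cov [FiniteDimensional ℝ E] [T2Space M]
    {cov : CovariantDerivative I F V}
    (hcov : CovariantDerivative.ContMDiffCovariantDerivative cov ∞) {σ : Π q : M, V q} {p : M}
    (hσ : SmoothNear I F σ p) :
    SmoothNear (V := fun q : M ↦ TangentSpace I q →L[ℝ] V q) I (E →L[ℝ] F) (cov σ) p := by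
  -- Smoothness of a connection speaks of globally smooth sections; locality of the connection
  -- allows passing to a global one with the same germ.
  obtain ⟨σ', hσ', h⟩ := hσ.exists_contMDiff_eq
  have h1 := hcov.contMDiff.contMDiff (σ := σ') (by simpa using hσ'.contMDiffOn)
  refine (SmoothNear.of_contMDiff (contMDiffOn_univ.1 h1)).congr ?_
  filter_upwards [eventually_eventually_nhds.2 h, hσ] with q hq hσq
  exact cov.isCovariantDerivativeOn.congr_of_eventuallyEq (hσq.mdifferentiableAt (by simp))
    (hσ'.contMDiffAt.mdifferentiableAt (by simp)) Filter.univ_mem (hq.mono fun _ h ↦ h.symm)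

lemma SmoothNear.clm_apply {V' : M → Type*} {F' : Type*} [NormedAddCommGroup F']
    [NormedSpace ℝ F'] [TopologicalSpace (TotalSpace F' V')]
    [∀ x, AddCommGroup (V' x)] [∀ x, Module ℝ (V' x)] [∀ x, TopologicalSpace (V' x)]
    [FiberBundle F' V'] [VectorBundle ℝ F' V']
    {A : Π q : M, V' q →L[ℝ] V q} {σ : Π q : M, V' q} {p : M}
    (hA : SmoothNear (V := fun q : M ↦ V' q →L[ℝ] V q) I (F' →L[ℝ] F) A p)
    (hσ : SmoothNear I F' σ p) : SmoothNear I F (fun q ↦ A q (σ q)) p := by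
  filter_upwards [hA, hσ] with q h h' using h.clm_bundle_apply h'

/-- A section `A` of a bundle of homomorphisms is smooth if its values on smooth sections are. -/
lemma contMDiffAt_hom_of_apply {V' : M → Type*} {F' : Type*} [NormedAddCommGroup F']
    [NormedSpace ℝ F'] [FiniteDimensional ℝ F'] [TopologicalSpace (TotalSpace F' V')]
    [∀ x, AddCommGroup (V' x)] [∀ x, Module ℝ (V' x)] [∀ x, TopologicalSpace (V' x)]
    [FiberBundle F' V'] [VectorBundle ℝ F' V'] [ContMDiffVectorBundle ∞ F' V' I]
    {A : Π q : M, V' q →L[ℝ] V q} {p : M}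
    (hA : ∀ σ : Π q : M, V' q, SmoothNear I F' σ p → CMDiffAt ∞ (T% (fun q ↦ A q (σ q))) p) :
    ContMDiffAt I (I.prod 𝓘(ℝ, F' →L[ℝ] F)) ∞
      (fun q ↦ TotalSpace.mk' (E := fun q : M ↦ V' q →L[ℝ] V q) (F' →L[ℝ] F) q (A q)) p := by
  rw [contMDiffAt_hom_bundle]
  refine ⟨contMDiffAt_id, ?_⟩
  let b := Module.finBasis ℝ F'
  let t := trivializationAt F' V' p
  let c (i) : F' →L[ℝ] ℝ := LinearMap.toContinuousLinearMap (b.coord i)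
  -- In the trivializations `A` is the sum over the basis of (coordinate functional) ⊗ (value on the
  -- frame vector), so smooth columns suffice.
  have h1 (i) : CMDiffAt ∞ (fun q ↦ (ContinuousLinearMap.smulRightL ℝ F' F (c i))
      (trivializationAt F V p ⟨q, A q (t.localFrame b i q)⟩).2) p := by
    have := (contMDiffAt_totalSpace.1 (hA _ (.localFrame b i))).2
    exact (ContinuousLinearMap.contMDiff _).contMDiffAt.comp p this
  have h2 := contMDiffAt_finsetSum (t := Finset.univ) (fun i _ ↦ h1 i)
  refine h2.congr_of_eventuallyEq ?_
  filter_upwards [t.open_baseSet.mem_nhds (FiberBundle.mem_baseSet_trivializationAt F' V' p),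
    (trivializationAt F V p).open_baseSet.mem_nhds
      (FiberBundle.mem_baseSet_trivializationAt F V p)] with q hq hq'
  refine ContinuousLinearMap.coe_injective (b.ext fun j ↦ ?_)
  have hj : t.localFrame b j q = t.symm q (b j) := by
    simp [Trivialization.basisAt, hq]
  simp [ContinuousLinearMap.inCoordinates_eq hq hq', c, Finsupp.single_apply, hj, t]

end Hom

end LocalSections

/-! ### Lie brackets and the tensoriality of curvature. -/

noncomputable section CurvatureTensor

open VectorField

variable
  {E : Type*} [NormedAddCommGroup E] [NormedSpace ℝ E] [FiniteDimensional ℝ E]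
  {H : Type*} [TopologicalSpace H] {I : ModelWithCorners ℝ E H}
  {M : Type*} [TopologicalSpace M] [ChartedSpace H M] [IsManifold I ∞ M]
  {p : M}

lemma eventually_contMDiffAt_mvfderiv_apply {f : M → ℝ} {Y : Π q : M, TangentSpace I q}
    (hf : ∀ᶠ q in 𝓝 p, CMDiffAt ∞ f q) (hY : SmoothNear I E Y p) :
    ∀ᶠ q in 𝓝 p, CMDiffAt ∞ (fun q ↦ mvfderiv I f q (Y q)) q := by
  filter_upwards [hf, hY] with q hf hY
  have h := ContMDiffAt.clm_apply_of_inCoordinates (b₁ := id) (b₂ := f) (v := Y)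
    (ϕ := fun q ↦ mfderiv I 𝓘(ℝ) f q) (hf.mfderiv_const (m := ∞) (by simp)) hY hf
  have h2 := (contMDiffAt_totalSpace.1 h).2
  simpa [mvfderiv] using! h2

lemma SmoothNear.mlieBracket {X Y : Π q : M, TangentSpace I q}
    (hX : SmoothNear I E X p) (hY : SmoothNear I E Y p) :
    SmoothNear I E (mlieBracket I X Y) p := by
  have : IsManifold I (((⊤ : ℕ∞) : ℕ∞ω) + 1) M := by simpa
  have : IsManifold I (minSmoothness ℝ 2) M := by
    simp only [minSmoothness_of_isRCLikeNormedField]; infer_instance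
  filter_upwards [hX, hY] with q hX hY
  exact ContMDiffAt.mlieBracket_vectorField (n := ⊤) (m := ⊤) hX hY (by simp)

/-- `[X, Y]` acts on functions as the commutator of `X` and `Y`. -/
lemma mvfderiv_mlieBracket {f : M → ℝ} {X Y : Π q : M, TangentSpace I q}
    (hf : ∀ᶠ q in 𝓝 p, CMDiffAt ∞ f q) (hX : SmoothNear I E X p) (hY : SmoothNear I E Y p) :
    mvfderiv I f p (mlieBracket I X Y p) =
      mvfderiv I (fun q ↦ mvfderiv I f q (Y q)) p (X p) -
        mvfderiv I (fun q ↦ mvfderiv I f q (X q)) p (Y p) := by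
  have : IsManifold I (minSmoothness ℝ 3) M := by
    simp only [minSmoothness_of_isRCLikeNormedField]; infer_instance
  rcases subsingleton_or_nontrivial E with hE | hE
  · have h0 (v : TangentSpace I p) : v = 0 := Subsingleton.elim (α := E) v 0
    rw [h0 (X p), h0 (Y p), h0 (mlieBracket I X Y p)]
    simp
  obtain ⟨z, hz⟩ := exists_ne (0 : E)
  let Z : Π q : M, TangentSpace I q := FiberBundle.extend E (x := p) (z : TangentSpace I p)
  have hZ : SmoothNear I E Z p := .extend _
  have hZp : Z p = z := FiberBundle.extend_apply_self ..
  have hfd {q} (h : CMDiffAt ∞ f q) : MDiffAt f q := h.mdifferentiableAt (by simp)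
  -- The Jacobi identity for `X`, `Y`, `f • Z`, expanded by the Leibniz rule, is compared with `f p`
  -- times the identity for `X`, `Y`, `Z`. The mixed first-order terms are symmetric in `X` and `Y`
  -- and cancel; what remains is the claim, as a coefficient of the nonzero vector `Z p`.
  have step {X Y : Π q : M, TangentSpace I q}
      (hX : SmoothNear I E X p) (hY : SmoothNear I E Y p) :
      mlieBracket I X (mlieBracket I Y (f • Z)) p =
        mvfderiv I (fun q ↦ mvfderiv I f q (Y q)) p (X p) • Z p
          + mvfderiv I f p (Y p) • mlieBracket I X Z p
          + (mvfderiv I f p (X p) • mlieBracket I Y Z p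
            + f p • mlieBracket I X (mlieBracket I Y Z) p) := by
    have h1 : mlieBracket I Y (f • Z) =ᶠ[𝓝 p]
        ((fun q ↦ mvfderiv I f q (Y q)) • Z + f • mlieBracket I Y Z : Π q : M, TangentSpace I q) := by
      filter_upwards [hf, hZ] with q hf hZ
      exact mlieBracket_smul_right (hfd hf) (hZ.mdifferentiableAt (by simp))
    have hYf := eventually_contMDiffAt_mvfderiv_apply hf hY
    rw [Filter.EventuallyEq.mlieBracket_vectorField_eq (.refl _ X) h1,
      mlieBracket_add_right (SmoothNear.smul hYf hZ).mdifferentiableAt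
        (SmoothNear.smul hf (hY.mlieBracket hZ)).mdifferentiableAt,
      mlieBracket_smul_right (hYf.self_of_nhds.mdifferentiableAt (by simp)) hZ.mdifferentiableAt,
      mlieBracket_smul_right (hfd hf.self_of_nhds) (hY.mlieBracket hZ).mdifferentiableAt]
  have two {W : Π q : M, TangentSpace I q} (hW : SmoothNear I E W p) :
      CMDiffAt (minSmoothness ℝ 2) (T% W) p := by
    simp only [minSmoothness_of_isRCLikeNormedField]
    exact hW.contMDiffAt.of_le ENat.LEInfty.out
  have J1 := leibniz_identity_mlieBracket_apply (two hX) (two hY) (two (.smul hf hZ))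
  have J2 := leibniz_identity_mlieBracket_apply (two hX) (two hY) (two hZ)
  rw [step hX hY, step hY hX,
    mlieBracket_smul_right (hfd hf.self_of_nhds) hZ.mdifferentiableAt, J2] at J1
  have J3 : (mvfderiv I f p (mlieBracket I X Y p)
      - (mvfderiv I (fun q ↦ mvfderiv I f q (Y q)) p (X p) -
        mvfderiv I (fun q ↦ mvfderiv I f q (X q)) p (Y p))) • Z p = 0 := by
    linear_combination (norm := module) -J1
  rcases smul_eq_zero.1 J3 with h | h
  · linarith
  · exact absurd (hZp.symm.trans h) hz

variable {F : Type*} [NormedAddCommGroup F] [NormedSpace ℝ F] [FiniteDimensional ℝ F]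
  {V : M → Type*} [TopologicalSpace (TotalSpace F V)]
  [∀ x, AddCommGroup (V x)] [∀ x, Module ℝ (V x)] [∀ x, TopologicalSpace (V x)]
  [∀ x, IsTopologicalAddGroup (V x)] [∀ x, ContinuousSMul ℝ (V x)]
  [FiberBundle F V] [VectorBundle ℝ F V] [ContMDiffVectorBundle ∞ F V I] [T2Space M]

namespace CovariantDerivative

/-- `∇_X ∇_Y σ - ∇_Y ∇_X σ - ∇_{[X, Y]} σ` for vector fields `X`, `Y` and a section `σ`. -/
def curvatureOfSections (cov : CovariantDerivative I F V) (X Y : Π q : M, TangentSpace I q)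
    (σ : Π q : M, V q) (p : M) : V p :=
  cov (fun q ↦ cov σ q (Y q)) p (X p) - cov (fun q ↦ cov σ q (X q)) p (Y p)
    - cov σ p (mlieBracket I X Y p)

variable {cov : CovariantDerivative I F V} {X Y : Π q : M, TangentSpace I q} {σ : Π q : M, V q}

lemma curvatureOfSections_swap :
    cov.curvatureOfSections X Y σ p = - cov.curvatureOfSections Y X σ p := by
  unfold curvatureOfSections
  rw [mlieBracket_swap]
  simp
  abel

lemma congr_of_smoothNear {σ τ : Π q : M, V q}
    (hσ : SmoothNear I F σ p) (hτ : SmoothNear I F τ p) (h : ∀ᶠ q in 𝓝 p, σ q = τ q) :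
    cov σ p = cov τ p :=
  cov.isCovariantDerivativeOn.congr_of_eventuallyEq hσ.mdifferentiableAt hτ.mdifferentiableAt
    Filter.univ_mem h

variable (hcov : ContMDiffCovariantDerivative cov ∞)
include hcov

lemma curvatureOfSections_smoothNear (hX : SmoothNear I E X p) (hY : SmoothNear I E Y p)
    (hσ : SmoothNear I F σ p) :
    SmoothNear I F (fun q ↦ cov.curvatureOfSections X Y σ q) p :=
  ((SmoothNear.cov hcov ((SmoothNear.cov hcov hσ).clm_apply hY)).clm_apply hX |>.sub
    ((SmoothNear.cov hcov ((SmoothNear.cov hcov hσ).clm_apply hX)).clm_apply hY)).sub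
    ((SmoothNear.cov hcov hσ).clm_apply (hX.mlieBracket hY))

/-- The term in which `Y` differentiates the factor `f` is cancelled by the corresponding term of
[fX, Y]. -/
lemma curvatureOfSections_tensorial_left (hσ : SmoothNear I F σ p) :
    SmoothTensorialAt I E (fun X ↦ cov.curvatureOfSections X Y σ p) p where
  smul {f X} hf hX := by
    have hfd : MDiffAt f p := hf.self_of_nhds.mdifferentiableAt (by simp)
    have hX' := (SmoothNear.cov hcov hσ).clm_apply hX
    have h := cov.isCovariantDerivativeOn.leibniz hX'.mdifferentiableAt hfd
    have e : (fun q ↦ cov σ q ((f • X) q)) = f • fun q ↦ cov σ q (X q) := by ext q; simp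
    simp only [curvatureOfSections, e, h, mlieBracket_smul_left hfd hX.mdifferentiableAt]
    simp
    module
  add {X X'} hX hX' := by
    have h := cov.isCovariantDerivativeOn.add
      ((SmoothNear.cov hcov hσ).clm_apply hX).mdifferentiableAt
      ((SmoothNear.cov hcov hσ).clm_apply hX').mdifferentiableAt
    have e : (fun q ↦ cov σ q ((X + X') q)) =
      (fun q ↦ cov σ q (X q)) + fun q ↦ cov σ q (X' q) := by ext q; simp
    simp only [curvatureOfSections, e, h,
      mlieBracket_add_left hX.mdifferentiableAt hX'.mdifferentiableAt]
    simp
    module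
  congr {X X'} hX hX' h := by
    have h1 := congr_of_smoothNear (cov := cov) ((SmoothNear.cov hcov hσ).clm_apply hX)
      ((SmoothNear.cov hcov hσ).clm_apply hX') (h.mono fun q hq ↦ by simp [hq])
    simp only [curvatureOfSections, h1, h.self_of_nhds,
      Filter.EventuallyEq.mlieBracket_vectorField_eq h (.refl _ Y)]

lemma curvatureOfSections_tensorial_middle (hσ : SmoothNear I F σ p) :
    SmoothTensorialAt I E (fun Y ↦ cov.curvatureOfSections X Y σ p) p where
  smul hf hY := by
    rw [curvatureOfSections_swap, (curvatureOfSections_tensorial_left hcov hσ).smul hf hY,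
      curvatureOfSections_swap, smul_neg, neg_neg]
  add {Y Y'} hY hY' := by
    rw [curvatureOfSections_swap, (curvatureOfSections_tensorial_left hcov hσ).add hY hY',
      curvatureOfSections_swap (X := Y), curvatureOfSections_swap (X := Y')]
    simp
    abel
  congr hY hY' h := by
    rw [curvatureOfSections_swap, (curvatureOfSections_tensorial_left hcov hσ).congr hY hY' h,
      ← curvatureOfSections_swap]

/-- Replacing σ by fσ produces first-derivative cross terms symmetric in `X` and `Y`, and the terms
(XYf - YXf)σ and -([X, Y]f)σ, which cancel by `mvfderiv_mlieBracket`. -/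
lemma curvatureOfSections_tensorial_right (hX : SmoothNear I E X p)
    (hY : SmoothNear I E Y p) :
    SmoothTensorialAt I F (fun σ ↦ cov.curvatureOfSections X Y σ p) p where
  smul {f σ} hf hσ := by
    have hfd : MDiffAt f p := hf.self_of_nhds.mdifferentiableAt (by simp)
    have step {X Y : Π q : M, TangentSpace I q}
        (hX : SmoothNear I E X p) (hY : SmoothNear I E Y p) :
        cov (fun q ↦ cov (f • σ) q (Y q)) p (X p) =
          f p • cov (fun q ↦ cov σ q (Y q)) p (X p) + mvfderiv I f p (X p) • cov σ p (Y p)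
          + (mvfderiv I f p (Y p) • cov σ p (X p)
            + mvfderiv I (fun q ↦ mvfderiv I f q (Y q)) p (X p) • σ p) := by
      have hYf := eventually_contMDiffAt_mvfderiv_apply hf hY
      have hσY := (SmoothNear.cov hcov hσ).clm_apply hY
      rw [congr_of_smoothNear (τ := f • (fun q ↦ cov σ q (Y q)) +
          (fun q ↦ mvfderiv I f q (Y q)) • σ)
        ((SmoothNear.cov hcov (.smul hf hσ)).clm_apply hY) (.add (.smul hf hσY) (.smul hYf hσ))]
      · rw [cov.isCovariantDerivativeOn.add (SmoothNear.smul hf hσY).mdifferentiableAt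
          (SmoothNear.smul hYf hσ).mdifferentiableAt,
          cov.isCovariantDerivativeOn.leibniz hσY.mdifferentiableAt hfd,
          cov.isCovariantDerivativeOn.leibniz hσ.mdifferentiableAt
            (hYf.self_of_nhds.mdifferentiableAt (by simp))]
        simp
      · filter_upwards [hf, hσ] with q hf hσ
        rw [cov.isCovariantDerivativeOn.leibniz (hσ.mdifferentiableAt (by simp))
          (hf.mdifferentiableAt (by simp))]
        simp
    simp only [curvatureOfSections]
    rw [step hX hY, step hY hX,
      cov.isCovariantDerivativeOn.leibniz hσ.mdifferentiableAt hfd]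
    simp [mvfderiv_mlieBracket hf hX hY]
    module
  add {σ σ'} hσ hσ' := by
    have step {X Y : Π q : M, TangentSpace I q}
        (hX : SmoothNear I E X p) (hY : SmoothNear I E Y p) :
        cov (fun q ↦ cov (σ + σ') q (Y q)) p (X p) =
          cov (fun q ↦ cov σ q (Y q)) p (X p) + cov (fun q ↦ cov σ' q (Y q)) p (X p) := by
      have h1 := (SmoothNear.cov hcov hσ).clm_apply hY
      have h2 := (SmoothNear.cov hcov hσ').clm_apply hY
      rw [congr_of_smoothNear (τ := (fun q ↦ cov σ q (Y q)) + fun q ↦ cov σ' q (Y q))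
        ((SmoothNear.cov hcov (hσ.add hσ')).clm_apply hY) (h1.add h2)]
      · rw [cov.isCovariantDerivativeOn.add h1.mdifferentiableAt h2.mdifferentiableAt]
        simp
      · filter_upwards [hσ, hσ'] with q h h'
        rw [cov.isCovariantDerivativeOn.add (h.mdifferentiableAt (by simp))
          (h'.mdifferentiableAt (by simp))]
        simp
    simp only [curvatureOfSections]
    rw [step hX hY, step hY hX,
      cov.isCovariantDerivativeOn.add hσ.mdifferentiableAt hσ'.mdifferentiableAt]
    simp
    abel
  congr {σ σ'} hσ hσ' h := by
    have step {X Y : Π q : M, TangentSpace I q}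
        (hX : SmoothNear I E X p) (hY : SmoothNear I E Y p) :
        cov (fun q ↦ cov σ q (Y q)) p = cov (fun q ↦ cov σ' q (Y q)) p := by
      refine congr_of_smoothNear ((SmoothNear.cov hcov hσ).clm_apply hY)
        ((SmoothNear.cov hcov hσ').clm_apply hY) ?_
      filter_upwards [hσ.eventually, hσ'.eventually, eventually_eventually_nhds.2 h] with q h1 h2 h3
      rw [congr_of_smoothNear h1 h2 h3]
    simp only [curvatureOfSections]
    rw [step hX hY, step hY hX, congr_of_smoothNear hσ hσ' h]

end CovariantDerivative

end CurvatureTensor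

/-! ### Basis independence of traces, and smooth orthonormal frames. -/

noncomputable section OrthonormalFrames

/-- The trace of a bilinear map with respect to an orthonormal basis does not depend on the
basis. -/
lemma OrthonormalBasis.sum_bilin_eq {V W ι ι' : Type*} [Fintype ι] [Fintype ι']
    [NormedAddCommGroup V] [InnerProductSpace ℝ V] [AddCommGroup W] [Module ℝ W]
    (b : OrthonormalBasis ι ℝ V) (b' : OrthonormalBasis ι' ℝ V) (B : V →ₗ[ℝ] V →ₗ[ℝ] W) :
    ∑ i, B (b i) (b i) = ∑ j, B (b' j) (b' j) := by
  classical
  have h (i) : B (b i) (b i) =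
      ∑ j, ∑ k, (inner ℝ (b' j) (b i) * inner ℝ (b i) (b' k)) • B (b' j) (b' k) := by
    conv_lhs => rw [← b'.sum_repr' (b i)]
    simp only [map_sum, LinearMap.sum_apply, map_smul, LinearMap.smul_apply, Finset.smul_sum, smul_smul]
    rw [Finset.sum_comm]
    refine Finset.sum_congr rfl fun j _ ↦ Finset.sum_congr rfl fun k _ ↦ ?_
    rw [real_inner_comm (b i) (b' k), mul_comm]
  simp only [h]
  rw [Finset.sum_comm]
  refine Finset.sum_congr rfl fun j _ ↦ ?_
  rw [Finset.sum_comm]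
  simp only [← Finset.sum_smul, b.sum_inner_mul_inner,
    orthonormal_iff_ite.1 b'.orthonormal, ite_smul, one_smul, zero_smul]
  simp

variable
  {E : Type*} [NormedAddCommGroup E] [NormedSpace ℝ E]
  {H : Type*} [TopologicalSpace H] {I : ModelWithCorners ℝ E H}
  {M : Type*} [TopologicalSpace M] [ChartedSpace H M] [IsManifold I ∞ M]
  {F : Type*} [NormedAddCommGroup F] [NormedSpace ℝ F] [FiniteDimensional ℝ F]
  {V : M → Type*} [TopologicalSpace (TotalSpace F V)]
  [∀ x, NormedAddCommGroup (V x)] [∀ x, InnerProductSpace ℝ (V x)]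
  [FiberBundle F V] [VectorBundle ℝ F V] [ContMDiffVectorBundle ∞ F V I]
  [IsContMDiffRiemannianBundle I ∞ F V] {p : M}

lemma SmoothNear.inner_bundle {σ τ : Π q : M, V q} (hσ : SmoothNear I F σ p) (hτ : SmoothNear I F τ p) :
    ∀ᶠ q in 𝓝 p, CMDiffAt ∞ (fun q ↦ inner ℝ (σ q) (τ q)) q := by
  filter_upwards [hσ, hτ] with q h h' using h.inner_bundle h'

/-- Strong induction: each projection coefficient is a quotient of inner products of sections
already known to be smooth, and linear independence keeps the denominators nonzero. -/
lemma SmoothNear.gramSchmidt {n : ℕ} {s : Fin n → Π q : M, V q}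
    (hs : ∀ i, SmoothNear I F (s i) p)
    (hli : ∀ᶠ q in 𝓝 p, LinearIndependent ℝ (fun i ↦ s i q)) (i : Fin n) :
    SmoothNear I F (fun q ↦ InnerProductSpace.gramSchmidt ℝ (fun i ↦ s i q) i) p := by
  induction i using WellFoundedLT.induction with
  | ind i ih =>
    have hterm (j) (hj : j < i) : SmoothNear I F (fun q ↦
        (inner ℝ (InnerProductSpace.gramSchmidt ℝ (fun i ↦ s i q) j) (s i q) *
          (inner ℝ (InnerProductSpace.gramSchmidt ℝ (fun i ↦ s i q) j)
            (InnerProductSpace.gramSchmidt ℝ (fun i ↦ s i q) j))⁻¹ : ℝ) •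
          InnerProductSpace.gramSchmidt ℝ (fun i ↦ s i q) j) p := by
      refine SmoothNear.smul ?_ (ih j hj)
      filter_upwards [(ih j hj).inner_bundle (hs i), (ih j hj).inner_bundle (ih j hj), hli] with q h1 h2 h3
      refine h1.mul (h2.inv₀ ?_)
      simpa using InnerProductSpace.gramSchmidt_ne_zero j h3
    refine ((hs i).sub (SmoothNear.sum (s := Finset.Iio i)
      fun j hj ↦ hterm j (Finset.mem_Iio.1 hj))).congr (.of_forall fun q ↦ ?_)
    rw [InnerProductSpace.gramSchmidt_def]
    simp only [Pi.sub_apply]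
    congr 1
    refine Finset.sum_congr rfl fun j _ ↦ ?_
    rw [Submodule.starProjection_singleton, real_inner_self_eq_norm_sq]
    simp [div_eq_mul_inv]

variable (I F) in
/-- A Euclidean vector bundle has local smooth orthonormal frames. -/
lemma exists_smoothNear_orthonormal (p : M) :
    ∃ e : Fin (Module.finrank ℝ F) → Π q : M, V q, (∀ i, SmoothNear I F (e i) p) ∧
      ∀ᶠ q in 𝓝 p, ∃ b : OrthonormalBasis (Fin (Module.finrank ℝ F)) ℝ (V q), ∀ i, b i = e i q := by
  let t := trivializationAt F V p
  let b := Module.finBasis ℝ F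
  have hbase : ∀ᶠ q in 𝓝 p, q ∈ t.baseSet := t.open_baseSet.mem_nhds
    (FiberBundle.mem_baseSet_trivializationAt F V p)
  have hli : ∀ᶠ q in 𝓝 p, LinearIndependent ℝ (fun i ↦ t.localFrame b i q) :=
    hbase.mono fun q hq ↦ (t.isLocalFrameOn_localFrame_baseSet I 1 b).linearIndependent hq
  have hgs := SmoothNear.gramSchmidt (I := I) (fun i ↦ SmoothNear.localFrame (p := p) b i) hli
  refine ⟨fun i q ↦ InnerProductSpace.gramSchmidtNormed ℝ (fun i ↦ t.localFrame b i q) i,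
    fun i ↦ ?_, ?_⟩
  · refine (SmoothNear.smul (f := fun q ↦ (√(inner ℝ
      (InnerProductSpace.gramSchmidt ℝ (fun i ↦ t.localFrame b i q) i)
      (InnerProductSpace.gramSchmidt ℝ (fun i ↦ t.localFrame b i q) i)))⁻¹) ?_ (hgs i)).congr
      (.of_forall fun q ↦ ?_)
    · filter_upwards [(hgs i).inner_bundle (hgs i), hli] with q h1 h2
      have h0 := InnerProductSpace.gramSchmidt_ne_zero (𝕜 := ℝ) i h2
      refine ContMDiffAt.inv₀ ?_ (by simpa [Real.sqrt_eq_zero'] using h0)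
      exact (Real.contDiffAt_sqrt (by simpa using h0)).contMDiffAt.comp q h1
    · simp [InnerProductSpace.gramSchmidtNormed, t]
  · filter_upwards [hli, hbase] with q hq hqb
    have ho := InnerProductSpace.gramSchmidtNormed_orthonormal hq
    have : FiniteDimensional ℝ (V q) := VectorBundle.finiteDimensional ℝ F V q
    have hcard : Fintype.card (Fin (Module.finrank ℝ F)) = Module.finrank ℝ (V q) := by
      rw [Fintype.card_fin, (t.linearEquivAt ℝ q hqb).finrank_eq]
    refine ⟨OrthonormalBasis.mk ho ?_, fun i ↦ congrFun (OrthonormalBasis.coe_mk ho _) i⟩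
    rw [ho.linearIndependent.span_eq_top_of_card_eq_finrank' hcard]

end OrthonormalFrames

/-! ### Clifford multiplication, curvature operators and their smoothness. -/

noncomputable section DiracOperators

/-- This turns the sum over i < j defining 𝓡 into a full double sum, where the orthonormal basis can
be changed one index at a time. -/
lemma Finset.sum_sum_eq_two_nsmul_sum_Ioi {ι W : Type*} [Fintype ι] [LinearOrder ι]
    [LocallyFiniteOrderTop ι] [LocallyFiniteOrderBot ι] [AddCommGroup W] (g : ι → ι → W)
    (h0 : ∀ i, g i i = 0) (hg : ∀ i j, i ≠ j → g i j = g j i) :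
    ∑ i, ∑ j, g i j = 2 • ∑ i, ∑ j ∈ Finset.Ioi i, g i j := by
  have h1 := Finset.sum_sum_Ioi_add_eq_sum_sum_off_diag g
  have h2 (i : ι) : ∑ j ∈ {i}ᶜ, g j i = ∑ j, g i j := by
    rw [← Finset.sum_add_sum_compl {i} (g i)]
    simp only [Finset.sum_singleton, h0, zero_add]
    refine Finset.sum_congr rfl fun j hj ↦ hg j i ?_
    simpa using hj
  simp only [h2] at h1
  rw [← h1, Finset.smul_sum]
  refine Finset.sum_congr rfl fun i _ ↦ ?_
  rw [Finset.smul_sum]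
  refine Finset.sum_congr rfl fun j hj ↦ ?_
  rw [hg j i (Finset.mem_Ioi.1 hj).ne', two_nsmul]

variable
  {E : Type*} [NormedAddCommGroup E] [NormedSpace ℝ E] [FiniteDimensional ℝ E]
  {H : Type*} [TopologicalSpace H] {I : ModelWithCorners ℝ E H}
  {M : Type*} [TopologicalSpace M] [ChartedSpace H M] [IsManifold I ∞ M]
  [RiemannianBundle (fun x : M ↦ TangentSpace I x)]
  [IsContMDiffRiemannianBundle I ∞ E (fun x : M ↦ TangentSpace I x)]
  {F : Type*} [NormedAddCommGroup F] [NormedSpace ℝ F] [FiniteDimensional ℝ F]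
  {S : M → Type*} [TopologicalSpace (TotalSpace F S)]
  [∀ x, NormedAddCommGroup (S x)] [∀ x, InnerProductSpace ℝ (S x)]
  [FiberBundle F S] [VectorBundle ℝ F S] [ContMDiffVectorBundle ∞ F S I]
  [IsContMDiffRiemannianBundle I ∞ F S]

section Extend

variable {V : M → Type*} [TopologicalSpace (TotalSpace F V)]
  [∀ x, AddCommGroup (V x)] [∀ x, Module ℝ (V x)] [∀ x, TopologicalSpace (V x)]
  [FiberBundle F V] [VectorBundle ℝ F V] [ContMDiffVectorBundle ∞ F V I]
  {A : Type*} [AddCommGroup A] [Module ℝ A] {Φ : (Π q : M, V q) → A} {p : M}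

lemma SmoothTensorialAt.extend_add (hΦ : SmoothTensorialAt I F Φ p) (v w : V p) :
    Φ (FiberBundle.extend F (v + w)) = Φ (FiberBundle.extend F v) + Φ (FiberBundle.extend F w) := by
  rw [← hΦ.add (.extend v) (.extend w)]
  exact hΦ.pointwise (.extend _) (.add (.extend v) (.extend w)) (by simp)

lemma SmoothTensorialAt.extend_smul (hΦ : SmoothTensorialAt I F Φ p) (c : ℝ) (v : V p) :
    Φ (FiberBundle.extend F (c • v)) = c • Φ (FiberBundle.extend F v) := by
  rw [← hΦ.smul (f := fun _ ↦ c) (.of_forall fun _ ↦ contMDiffAt_const) (.extend v)]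
  exact hΦ.pointwise (.extend _)
    (.smul (.of_forall fun _ ↦ contMDiffAt_const) (.extend v)) (by simp)

end Extend

namespace DiracBundle

variable {nablaM : CovariantDerivative I E (fun x : M ↦ TangentSpace I x)}
  (𝒟 : DiracBundle F S nablaM) {p : M}

@[simp] lemma cmul_add_left (x y : TangentSpace I p) (s : S p) :
    𝒟.cmul p (x + y) s = 𝒟.cmul p x s + 𝒟.cmul p y s := by simp [cmul]

@[simp] lemma cmul_smul_left (c : ℝ) (x : TangentSpace I p) (s : S p) :
    𝒟.cmul p (c • x) s = c • 𝒟.cmul p x s := by simp [cmul]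

@[simp] lemma cmul_sub_left (x y : TangentSpace I p) (s : S p) :
    𝒟.cmul p (x - y) s = 𝒟.cmul p x s - 𝒟.cmul p y s := by simp [cmul]

/-- Polarization of x·x = -|x|². -/
lemma cmul_cmul_add_swap (x y : TangentSpace I p) (s : S p) :
    𝒟.cmul p x (𝒟.cmul p y s) + 𝒟.cmul p y (𝒟.cmul p x s) = (-2 * inner ℝ x y : ℝ) • s := by
  have h := congrArg (fun a ↦ 𝒟.action p a s)
    (CliffordAlgebra.ι_mul_ι_add_swap (Q := cliffordForm I p) x y)
  have hpol : QuadraticMap.polar (cliffordForm I p) x y = -2 * inner ℝ x y := by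
    simp [QuadraticMap.polar, cliffordForm, inner_add_right, real_inner_comm x y]
    ring
  rw [hpol] at h
  simpa [cmul, Algebra.algebraMap_eq_smul_one] using h

lemma cmul_cmul_self (x : TangentSpace I p) (s : S p) :
    𝒟.cmul p x (𝒟.cmul p x s) = -(inner ℝ x x : ℝ) • s := by
  have h := 𝒟.cmul_cmul_add_swap x x s
  have h2 : (2 : ℝ) • 𝒟.cmul p x (𝒟.cmul p x s) = (2 : ℝ) • (-(inner ℝ x x : ℝ) • s) := by
    rw [two_smul, h]; module
  exact smul_right_injective _ (two_ne_zero' ℝ) h2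

variable {X Y : Π q : M, TangentSpace I q} {σ : Π q : M, S q}

lemma smoothNear_cmul (hX : SmoothNear I E X p) (hσ : SmoothNear I F σ p) :
    SmoothNear I F (fun q ↦ 𝒟.cmul q (X q) (σ q)) p := by
  filter_upwards [hX, hσ] with q h h' using 𝒟.action_smooth q X σ h h'

/-- The only case of the Dirac bundle's Leibniz rule that the argument needs. -/
lemma nabla_cmul (hX : SmoothNear I E X p) (hσ : SmoothNear I F σ p) (x : TangentSpace I p) :
    𝒟.nabla (fun q ↦ 𝒟.cmul q (X q) (σ q)) p x =
      𝒟.cmul p (nablaM X p x) (σ p) + 𝒟.cmul p (X p) (𝒟.nabla σ p x) :=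
  𝒟.leibniz p _ _ σ (.vector hX.contMDiffAt) hσ.contMDiffAt x

variable [T2Space M]

lemma smoothNear_nabla (hσ : SmoothNear I F σ p) (hX : SmoothNear I E X p) :
    SmoothNear I F (fun q ↦ 𝒟.nabla σ q (X q)) p :=
  (SmoothNear.cov 𝒟.nabla_smooth hσ).clm_apply hX

lemma curvature_eq_extend (x y : TangentSpace I p) (s : S p) :
    𝒟.curvature p x y s = 𝒟.nabla.curvatureOfSections (FiberBundle.extend E x)
      (FiberBundle.extend E y) (FiberBundle.extend F s) p := by
  simp [curvature, CovariantDerivative.curvatureOfSections]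

/-- By tensoriality the three canonical extensions are exchanged for arbitrary ones, one argument at
a time. -/
lemma curvature_apply (hX : SmoothNear I E X p) (hY : SmoothNear I E Y p)
    (hσ : SmoothNear I F σ p) :
    𝒟.curvature p (X p) (Y p) (σ p) = 𝒟.nabla.curvatureOfSections X Y σ p := by
  have h := 𝒟.nabla_smooth
  rw [curvature_eq_extend,
    (CovariantDerivative.curvatureOfSections_tensorial_left h (.extend _)).pointwise
      (.extend _) hX (by simp),
    (CovariantDerivative.curvatureOfSections_tensorial_middle h (.extend _)).pointwise
      (.extend _) hY (by simp),
    (CovariantDerivative.curvatureOfSections_tensorial_right h hX hY).pointwise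
      (.extend _) hσ (by simp)]

/-- The curvature of `S` as a trilinear map. -/
def curvatureₗ (p : M) :
    TangentSpace I p →ₗ[ℝ] TangentSpace I p →ₗ[ℝ] S p →ₗ[ℝ] S p :=
  LinearMap.mk₂ ℝ
    (fun x y ↦
      { toFun s := 𝒟.nabla.curvatureOfSections (FiberBundle.extend E x)
          (FiberBundle.extend E y) (FiberBundle.extend F s) p
        map_add' := (CovariantDerivative.curvatureOfSections_tensorial_right 𝒟.nabla_smooth
          (.extend x) (.extend y)).extend_add
        map_smul' := (CovariantDerivative.curvatureOfSections_tensorial_right 𝒟.nabla_smooth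
          (.extend x) (.extend y)).extend_smul })
    (fun x x' _ ↦ LinearMap.ext fun s ↦
      (CovariantDerivative.curvatureOfSections_tensorial_left 𝒟.nabla_smooth
        (.extend s)).extend_add x x')
    (fun c x _ ↦ LinearMap.ext fun s ↦
      (CovariantDerivative.curvatureOfSections_tensorial_left 𝒟.nabla_smooth
        (.extend s)).extend_smul c x)
    (fun _ y y' ↦ LinearMap.ext fun s ↦
      (CovariantDerivative.curvatureOfSections_tensorial_middle 𝒟.nabla_smooth
        (.extend s)).extend_add y y')
    (fun c _ y ↦ LinearMap.ext fun s ↦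
      (CovariantDerivative.curvatureOfSections_tensorial_middle 𝒟.nabla_smooth
        (.extend s)).extend_smul c y)

lemma curvatureₗ_apply (x y : TangentSpace I p) (s : S p) :
    𝒟.curvatureₗ p x y s = 𝒟.curvature p x y s := (𝒟.curvature_eq_extend x y s).symm

lemma curvature_swap (x y : TangentSpace I p) (s : S p) :
    𝒟.curvature p x y s = -𝒟.curvature p y x s := by
  rw [curvature_eq_extend, curvature_eq_extend]
  exact CovariantDerivative.curvatureOfSections_swap

lemma curvature_self (x : TangentSpace I p) (s : S p) : 𝒟.curvature p x x s = 0 := by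
  have h := 𝒟.curvature_swap x x s
  rwa [eq_neg_iff_add_eq_zero, ← two_smul ℝ, smul_eq_zero_iff_right two_ne_zero] at h

lemma smoothNear_curvature (hX : SmoothNear I E X p) (hY : SmoothNear I E Y p)
    (hσ : SmoothNear I F σ p) : SmoothNear I F (fun q ↦ 𝒟.curvature q (X q) (Y q) (σ q)) p :=
  (CovariantDerivative.curvatureOfSections_smoothNear 𝒟.nabla_smooth hX hY hσ).congr <| by
    filter_upwards [hX.eventually, hY.eventually, hσ.eventually] with q h1 h2 h3
    exact 𝒟.curvature_apply h1 h2 h3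

section Frames

variable {ι : Type*} [Fintype ι] (b : OrthonormalBasis ι ℝ (TangentSpace I p))

/-- The bases `onb I p` are chosen point by point, with no regularity in `p`. Independence of the
basis allows a smooth local frame instead, which is how the smoothness lemmas below are obtained. -/
lemma dirac_eq_sum (σ : Π q : M, S q) :
    𝒟.dirac σ p = ∑ i, 𝒟.cmul p (b i) (𝒟.nabla σ p (b i)) :=
  (onb I p).sum_bilin_eq b (LinearMap.mk₂ ℝ (fun x y ↦ 𝒟.cmul p x (𝒟.nabla σ p y))
    (by simp) (by simp) (by simp) (by simp))

lemma ricci_eq_sum (x : TangentSpace I p) (s : S p) :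
    𝒟.ricci p x s = (2 : ℝ) • ∑ i, 𝒟.cmul p (b i) (𝒟.curvature p (b i) x s) := by
  have h := (onb I p).sum_bilin_eq b
    (LinearMap.mk₂ ℝ (fun y z ↦ 𝒟.cmul p y (𝒟.curvatureₗ p z x s))
      (by simp) (by simp) (by simp) (by simp))
  simp only [LinearMap.mk₂_apply, curvatureₗ_apply] at h
  rw [ricci, h]

lemma weitzenboeck_eq_sum (s : S p) :
    𝒟.weitzenboeck p s =
      (1 / 2 : ℝ) • ∑ i, ∑ j, 𝒟.cmul p (b i) (𝒟.cmul p (b j) (𝒟.curvature p (b i) (b j) s)) := by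
  have h1 : ∑ i, ∑ j, 𝒟.cmul p (onb I p i) (𝒟.cmul p (onb I p j)
        (𝒟.curvature p (onb I p i) (onb I p j) s)) = 2 • 𝒟.weitzenboeck p s := by
    -- For i ≠ j both e_i·e_j and R(e_i, e_j) change sign under the swap, so the summand is
    -- symmetric.
    refine Finset.sum_sum_eq_two_nsmul_sum_Ioi _ (fun i ↦ by simp [curvature_self])
      fun i j hij ↦ ?_
    have h := 𝒟.cmul_cmul_add_swap (onb I p i) (onb I p j)
      (𝒟.curvature p (onb I p i) (onb I p j) s)
    rw [(onb I p).orthonormal.2 hij, mul_zero, zero_smul] at h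
    rw [𝒟.curvature_swap (onb I p j), map_neg, map_neg]
    exact eq_neg_of_add_eq_zero_left h
  have h2 : ∑ i, ∑ j, 𝒟.cmul p (onb I p i) (𝒟.cmul p (onb I p j)
        (𝒟.curvature p (onb I p i) (onb I p j) s)) =
      ∑ i, ∑ j, 𝒟.cmul p (b i) (𝒟.cmul p (b j) (𝒟.curvature p (b i) (b j) s)) := by
    have step (x : TangentSpace I p) :=
      (onb I p).sum_bilin_eq b (LinearMap.mk₂ ℝ
        (fun y z ↦ 𝒟.cmul p x (𝒟.cmul p y (𝒟.curvatureₗ p x z s)))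
        (by simp) (by simp) (by simp) (by simp))
    have step' (y : TangentSpace I p) :=
      (onb I p).sum_bilin_eq b (LinearMap.mk₂ ℝ
        (fun x z ↦ 𝒟.cmul p x (𝒟.cmul p y (𝒟.curvatureₗ p z y s)))
        (by simp) (by simp) (by simp) (by simp))
    simp only [LinearMap.mk₂_apply, curvatureₗ_apply] at step step'
    simp only [step]
    rw [Finset.sum_comm]
    simp only [step']
    rw [Finset.sum_comm]
  rw [← h2, h1, ← Nat.cast_smul_eq_nsmul ℝ, smul_smul]
  simp

end Frames

lemma smoothNear_dirac (hσ : SmoothNear I F σ p) : SmoothNear I F (𝒟.dirac σ) p := by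
  obtain ⟨e, he, hb⟩ := exists_smoothNear_orthonormal (V := fun q : M ↦ TangentSpace I q) I E p
  refine (SmoothNear.sum (s := Finset.univ) fun i _ ↦
    𝒟.smoothNear_cmul (he i) (𝒟.smoothNear_nabla hσ (he i))).congr ?_
  filter_upwards [hb] with q ⟨b, hb⟩
  simp only [𝒟.dirac_eq_sum b, hb]

lemma smoothNear_ricci (hX : SmoothNear I E X p) (hσ : SmoothNear I F σ p) :
    SmoothNear I F (fun q ↦ 𝒟.ricci q (X q) (σ q)) p := by
  obtain ⟨e, he, hb⟩ := exists_smoothNear_orthonormal (V := fun q : M ↦ TangentSpace I q) I E p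
  refine (SmoothNear.const_smul 2 (SmoothNear.sum (s := Finset.univ) fun i _ ↦
    𝒟.smoothNear_cmul (he i) (𝒟.smoothNear_curvature (he i) hX hσ))).congr ?_
  filter_upwards [hb] with q ⟨b, hb⟩
  simp only [𝒟.ricci_eq_sum b, hb, Pi.smul_apply]

lemma smoothNear_weitzenboeck (hσ : SmoothNear I F σ p) :
    SmoothNear I F (fun q ↦ 𝒟.weitzenboeck q (σ q)) p := by
  obtain ⟨e, he, hb⟩ := exists_smoothNear_orthonormal (V := fun q : M ↦ TangentSpace I q) I E p
  refine (SmoothNear.const_smul (1 / 2) (SmoothNear.sum (s := Finset.univ) fun i _ ↦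
    SmoothNear.sum (s := Finset.univ) fun j _ ↦ 𝒟.smoothNear_cmul (he i)
      (𝒟.smoothNear_cmul (he j) (𝒟.smoothNear_curvature (he i) (he j) hσ)))).congr ?_
  filter_upwards [hb] with q ⟨b, hb⟩
  simp only [𝒟.weitzenboeck_eq_sum b, hb, Pi.smul_apply]

lemma smoothNear_curlyK (hX : SmoothNear I E X p) (hσ : SmoothNear I F σ p) :
    SmoothNear I F (fun q ↦ 𝒟.curlyK q (X q) (σ q)) p :=
  .const_smul _ (.sub (.const_smul _ (𝒟.smoothNear_cmul hX (𝒟.smoothNear_weitzenboeck hσ)))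
    (.const_smul _ (𝒟.smoothNear_ricci hX hσ)))

/-- The operator `K` as a bilinear map. -/
def curlyKₗ (p : M) : TangentSpace I p →ₗ[ℝ] S p →ₗ[ℝ] S p :=
  LinearMap.mk₂ ℝ (𝒟.curlyK p)
    (fun x x' s ↦ by
      simp only [curlyK, ricci, ← curvatureₗ_apply, map_add, LinearMap.add_apply,
        Finset.sum_add_distrib, cmul_add_left]
      module)
    (fun c x s ↦ by
      simp only [curlyK, ricci, ← curvatureₗ_apply, map_smul, LinearMap.smul_apply,
        ← Finset.smul_sum, cmul_smul_left]
      module)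
    (fun x s s' ↦ by
      simp only [curlyK, ricci, weitzenboeck, ← curvatureₗ_apply, map_add,
        Finset.sum_add_distrib]
      module)
    (fun c x s ↦ by
      simp only [curlyK, ricci, weitzenboeck, ← curvatureₗ_apply, map_smul,
        ← Finset.smul_sum]
      module)

end DiracBundle

end DiracOperators

/-! ### Prolongation of the twistor equation and the connection on S ⊕ S. -/

noncomputable section TwistorConnection

variable
  {E : Type*} [NormedAddCommGroup E] [NormedSpace ℝ E] [FiniteDimensional ℝ E]
  {H : Type*} [TopologicalSpace H] {I : ModelWithCorners ℝ E H}
  {M : Type*} [TopologicalSpace M] [ChartedSpace H M] [IsManifold I ∞ M]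
  [RiemannianBundle (fun x : M ↦ TangentSpace I x)]
  [IsContMDiffRiemannianBundle I ∞ E (fun x : M ↦ TangentSpace I x)]
  {F : Type*} [NormedAddCommGroup F] [NormedSpace ℝ F] [FiniteDimensional ℝ F]
  {S : M → Type*} [TopologicalSpace (TotalSpace F S)]
  [∀ x, NormedAddCommGroup (S x)] [∀ x, InnerProductSpace ℝ (S x)]
  [FiberBundle F S] [VectorBundle ℝ F S] [ContMDiffVectorBundle ∞ F S I]
  [IsContMDiffRiemannianBundle I ∞ F S] {p : M}

section ProdSection

variable {u : Π q : M, (S ×ᵇ S) q}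

lemma contMDiffAt_prod_section_iff {n : ℕ∞ω} :
    ContMDiffAt I (I.prod 𝓘(ℝ, F × F)) n (fun q ↦ TotalSpace.mk' (F × F) (E := S ×ᵇ S) q (u q)) p ↔
      CMDiffAt n (T% (fun q ↦ (u q).1)) p ∧ CMDiffAt n (T% (fun q ↦ (u q).2)) p := by
  rw [contMDiffAt_section, contMDiffAt_section, contMDiffAt_section]
  exact contMDiffAt_prod_module_iff _

lemma mdifferentiableAt_prod_section_iff :
    MDifferentiableAt I (I.prod 𝓘(ℝ, F × F))
        (fun q ↦ TotalSpace.mk' (F × F) (E := S ×ᵇ S) q (u q)) p ↔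
      MDiffAt (T% (fun q ↦ (u q).1)) p ∧ MDiffAt (T% (fun q ↦ (u q).2)) p := by
  rw [mdifferentiableAt_section, mdifferentiableAt_section, mdifferentiableAt_section]
  exact mdifferentiableAt_prod_module_iff _

end ProdSection

namespace DiracBundle

variable {nablaM : CovariantDerivative I E (fun x : M ↦ TangentSpace I x)}
  (𝒟 : DiracBundle F S nablaM)

section Twistor

variable [T2Space M] {X Y : Π q : M, TangentSpace I q} {σ : Π q : M, S q}

/-- On a twistor section the curvature is
`R(x, y) σ = (1 / n) (x · ∇_y D σ - y · ∇_x D σ)`. -/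
lemma curvature_of_isTwistor (hM : IsLeviCivita nablaM) {σ : Cₛ^∞⟮I; F, S⟯}
    (hσ : 𝒟.IsTwistor σ) (x y : TangentSpace I p) :
    𝒟.curvature p x y (σ p) = (1 / (Module.finrank ℝ E : ℝ)) •
      (𝒟.cmul p x (𝒟.nabla (𝒟.dirac σ) p y) - 𝒟.cmul p y (𝒟.nabla (𝒟.dirac σ) p x)) := by
  set c : ℝ := 1 / (Module.finrank ℝ E : ℝ) with hc
  have hs : SmoothNear I F σ p := .of_contMDiff σ.contMDiff
  have hD := 𝒟.smoothNear_dirac hs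
  have htw (q : M) (v : TangentSpace I q) :
      𝒟.nabla σ q v = -c • 𝒟.cmul q v (𝒟.dirac σ q) := by
    rw [neg_smul]; exact eq_neg_of_add_eq_zero_left (hσ q v)
  set X : Π q : M, TangentSpace I q := FiberBundle.extend E x with hX
  set Y : Π q : M, TangentSpace I q := FiberBundle.extend E y with hY
  have sX : SmoothNear I E X p := .extend x
  have sY : SmoothNear I E Y p := .extend y
  have hXp : X p = x := FiberBundle.extend_apply_self ..
  have hYp : Y p = y := FiberBundle.extend_apply_self ..
  have step {Z : Π q : M, TangentSpace I q} (sZ : SmoothNear I E Z p) (v : TangentSpace I p) :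
      𝒟.nabla (fun q ↦ 𝒟.nabla σ q (Z q)) p v =
        -c • (𝒟.cmul p (nablaM Z p v) (𝒟.dirac σ p)
          + 𝒟.cmul p (Z p) (𝒟.nabla (𝒟.dirac σ) p v)) := by
    have e : (fun q ↦ 𝒟.nabla σ q (Z q)) = -c • fun q ↦ 𝒟.cmul q (Z q) (𝒟.dirac σ q) := by
      ext q; exact htw q (Z q)
    rw [e, 𝒟.nabla.isCovariantDerivativeOn.smul_const _ (𝒟.smoothNear_cmul sZ hD).mdifferentiableAt,
      smul_apply, 𝒟.nabla_cmul sZ hD]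
  -- Writing [X, Y] as ∇_X Y - ∇_Y X cancels every term in which `Dσ` is not differentiated.
  have htor := nablaM.torsion_eq_zero_iff.1 hM.torsion_free
    sX.mdifferentiableAt sY.mdifferentiableAt
  have h := 𝒟.curvature_apply sX sY hs
  rw [hXp, hYp] at h
  rw [h, CovariantDerivative.curvatureOfSections, step sX, step sY, htw, ← htor,
    cmul_sub_left, hXp, hYp]
  module

/-- `hW` and `hR` are the two contractions of the curvature formula; the coefficients in K are those
that eliminate D²σ. -/
lemma nabla_dirac_of_isTwistor (hM : IsLeviCivita nablaM) (hn : 3 ≤ Module.finrank ℝ E)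
    {σ : Cₛ^∞⟮I; F, S⟯} (hσ : 𝒟.IsTwistor σ) (x : TangentSpace I p) :
    𝒟.nabla (𝒟.dirac σ) p x = 𝒟.curlyK p x (σ p) := by
  set n : ℝ := (Module.finrank ℝ E : ℝ) with hn'
  have hn3 : (3 : ℝ) ≤ n := by rw [hn']; exact_mod_cast hn
  set b := onb I p
  have hcard : (Fintype.card (Fin (Module.finrank ℝ (TangentSpace I p))) : ℝ) = n := by
    rw [Fintype.card_fin]; rfl
  set N := 𝒟.nabla (𝒟.dirac σ) p with hN
  have hDD : 𝒟.dirac (𝒟.dirac σ) p = ∑ i, 𝒟.cmul p (b i) (N (b i)) := rfl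
  have hW : 𝒟.weitzenboeck p (σ p) = ((n - 1) / n) • 𝒟.dirac (𝒟.dirac σ) p := by
    -- From e_i·e_j·e_i = e_j and e_i·e_j·e_j = -e_i for i ≠ j. The correction term makes the
    -- formula vanish on the diagonal.
    have hij (i j) : 𝒟.cmul p (b i) (𝒟.cmul p (b j) (𝒟.curvature p (b i) (b j) (σ p))) =
        (1 / n) • (𝒟.cmul p (b j) (N (b j)) + 𝒟.cmul p (b i) (N (b i))
          - if i = j then (2 : ℝ) • 𝒟.cmul p (b i) (N (b i)) else 0) := by
      rw [𝒟.curvature_of_isTwistor hM hσ, ← hN, ← hn']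
      rcases eq_or_ne i j with rfl | hij
      · simp; module
      · have h1 := 𝒟.cmul_cmul_add_swap (b i) (b j) (N (b j))
        rw [b.orthonormal.2 hij, mul_zero, zero_smul] at h1
        have h2 : 𝒟.cmul p (b j) (𝒟.cmul p (b i) (N (b j))) =
          -𝒟.cmul p (b i) (𝒟.cmul p (b j) (N (b j))) := eq_neg_of_add_eq_zero_right h1
        simp only [map_smul, map_sub, h2, map_neg, cmul_cmul_self, b.orthonormal.1, hij,
          real_inner_self_eq_norm_sq, if_false]
        module
    rw [𝒟.weitzenboeck_eq_sum b, hDD]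
    simp only [hij, ← Finset.smul_sum, Finset.sum_add_distrib, Finset.sum_sub_distrib,
      Finset.sum_const, Finset.sum_ite_eq, Finset.mem_univ, if_true, Finset.card_univ,
      ← Nat.cast_smul_eq_nsmul ℝ, hcard]
    module
  have hR : 𝒟.ricci p x (σ p) =
      (2 / n) • ((2 - n) • N x + 𝒟.cmul p x (𝒟.dirac (𝒟.dirac σ) p)) := by
    -- The inner product is moved inside `N` so that the sum over i rebuilds `x` from its
    -- coordinates.
    have hi (i) : 𝒟.cmul p (b i) (𝒟.curvature p (b i) x (σ p)) =
        (1 / n) • (-N x + (𝒟.cmul p x (𝒟.cmul p (b i) (N (b i)))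
          + (2 : ℝ) • N ((inner ℝ (b i) x : ℝ) • b i))) := by
      rw [𝒟.curvature_of_isTwistor hM hσ, ← hN, ← hn']
      have h1 := 𝒟.cmul_cmul_add_swap (b i) x (N (b i))
      have h2 := eq_sub_of_add_eq h1
      simp only [map_smul, map_sub, h2, cmul_cmul_self, b.orthonormal.1,
          real_inner_self_eq_norm_sq]
      module
    rw [𝒟.ricci_eq_sum b, hDD]
    simp only [hi, ← Finset.smul_sum, Finset.sum_add_distrib, ← map_sum, b.sum_repr',
      Finset.sum_const, Finset.card_univ, ← Nat.cast_smul_eq_nsmul ℝ, hcard]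
    module
  simp only [curlyK, hW, hR, ← hn']
  have h0 : n ≠ 0 := by linarith
  have h1 : n - 1 ≠ 0 := by linarith
  have h2 : n - 2 ≠ 0 := by linarith
  simp only [map_smul]
  match_scalars <;> field_simp <;> ring

end Twistor

section Connection

/-- Clifford multiplication `x ↦ x · s` on a fixed element. -/
def cmulRight (p : M) (s : S p) : TangentSpace I p →L[ℝ] S p :=
  LinearMap.toContinuousLinearMap
    { toFun x := 𝒟.cmul p x s
      map_add' x y := 𝒟.cmul_add_left x y s
      map_smul' c x := 𝒟.cmul_smul_left c x s }

variable [T2Space M]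

/-- The operator `x ↦ K_x s` for a fixed element `s`. -/
def curlyKRight (p : M) (s : S p) : TangentSpace I p →L[ℝ] S p :=
  LinearMap.toContinuousLinearMap ((𝒟.curlyKₗ p).flip s)

lemma curlyK_add_right (x : TangentSpace I p) (s t : S p) :
    𝒟.curlyK p x (s + t) = 𝒟.curlyK p x s + 𝒟.curlyK p x t := (𝒟.curlyKₗ p x).map_add s t

lemma curlyK_smul_right (x : TangentSpace I p) (c : ℝ) (s : S p) :
    𝒟.curlyK p x (c • s) = c • 𝒟.curlyK p x s := (𝒟.curlyKₗ p x).map_smul c s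

/-- The connection `((∇, (1 / n) L), (-K, ∇))` on `S ⊕ S`. -/
def twistorConnection : CovariantDerivative I (F × F) (S ×ᵇ S) where
  toFun u p :=
    (𝒟.nabla (fun q ↦ (u q).1) p
        + (1 / (Module.finrank ℝ E : ℝ)) • 𝒟.cmulRight p (u p).2).prod
      (-𝒟.curlyKRight p (u p).1 + 𝒟.nabla (fun q ↦ (u q).2) p)
  isCovariantDerivativeOnUniv :=
    { add := fun {u u' p} hu hu' _ ↦ by
        rw [mdifferentiableAt_prod_section_iff] at hu hu'
        have h1 := 𝒟.nabla.isCovariantDerivativeOn.add hu.1 hu'.1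
        have h2 := 𝒟.nabla.isCovariantDerivativeOn.add hu.2 hu'.2
        refine ContinuousLinearMap.ext fun x ↦ Prod.ext ?_ ?_
        · change 𝒟.nabla ((fun q ↦ (u q).1) + fun q ↦ (u' q).1) p x
              + (1 / (Module.finrank ℝ E : ℝ)) • 𝒟.cmul p x ((u p).2 + (u' p).2) =
            (𝒟.nabla (fun q ↦ (u q).1) p x + (1 / (Module.finrank ℝ E : ℝ)) • 𝒟.cmul p x (u p).2)
              + (𝒟.nabla (fun q ↦ (u' q).1) p x + (1 / (Module.finrank ℝ E : ℝ)) • 𝒟.cmul p x (u' p).2)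
          rw [h1, map_add, add_apply]
          module
        · change -𝒟.curlyK p x ((u p).1 + (u' p).1)
              + 𝒟.nabla ((fun q ↦ (u q).2) + fun q ↦ (u' q).2) p x =
            (-𝒟.curlyK p x (u p).1 + 𝒟.nabla (fun q ↦ (u q).2) p x)
              + (-𝒟.curlyK p x (u' p).1 + 𝒟.nabla (fun q ↦ (u' q).2) p x)
          rw [h2, curlyK_add_right, add_apply]
          module
      leibniz := fun {u g p} hu hg _ ↦ by
        rw [mdifferentiableAt_prod_section_iff] at hu
        have h1 := 𝒟.nabla.isCovariantDerivativeOn.leibniz hu.1 hg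
        have h2 := 𝒟.nabla.isCovariantDerivativeOn.leibniz hu.2 hg
        refine ContinuousLinearMap.ext fun x ↦ Prod.ext ?_ ?_
        · change 𝒟.nabla (g • fun q ↦ (u q).1) p x + (1 / (Module.finrank ℝ E : ℝ)) • 𝒟.cmul p x (g p • (u p).2) =
            g p • (𝒟.nabla (fun q ↦ (u q).1) p x + (1 / (Module.finrank ℝ E : ℝ)) • 𝒟.cmul p x (u p).2)
              + mvfderiv I g p x • (u p).1
          rw [h1, map_smul, add_apply, smul_apply, ContinuousLinearMap.smulRight_apply]
          module
        · change -𝒟.curlyK p x (g p • (u p).1) + 𝒟.nabla (g • fun q ↦ (u q).2) p x =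
            g p • (-𝒟.curlyK p x (u p).1 + 𝒟.nabla (fun q ↦ (u q).2) p x)
              + mvfderiv I g p x • (u p).2
          rw [h2, curlyK_smul_right, add_apply, smul_apply, ContinuousLinearMap.smulRight_apply]
          module }

lemma isTwistorConnection_twistorConnection :
    𝒟.IsTwistorConnection 𝒟.twistorConnection := fun _ _ _ _ ↦ rfl

/-- Smoothness of a Hom-valued section is tested on local vector fields and in each component
separately. -/
lemma contMDiff_twistorConnection :
    CovariantDerivative.ContMDiffCovariantDerivative 𝒟.twistorConnection ∞ := by
  refine ⟨⟨fun {u} hu p _ ↦ ContMDiffAt.contMDiffWithinAt ?_⟩⟩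
  have hu' (q : M) : ContMDiffAt I (I.prod 𝓘(ℝ, F × F)) ∞
      (fun q ↦ TotalSpace.mk' (F × F) (E := S ×ᵇ S) q (u q)) q :=
    ((hu q trivial).contMDiffAt Filter.univ_mem).of_le (by simp)
  have hu1 : SmoothNear I F (fun q ↦ (u q).1) p :=
    .of_forall fun q ↦ (contMDiffAt_prod_section_iff.1 (hu' q)).1
  have hu2 : SmoothNear I F (fun q ↦ (u q).2) p :=
    .of_forall fun q ↦ (contMDiffAt_prod_section_iff.1 (hu' q)).2
  refine contMDiffAt_hom_of_apply fun X hX ↦ contMDiffAt_prod_section_iff.2 ⟨?_, ?_⟩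
  · exact ((𝒟.smoothNear_nabla hu1 hX).add
      (.const_smul _ (𝒟.smoothNear_cmul hX hu2))).contMDiffAt
  · exact ((𝒟.smoothNear_curlyK hX hu1).neg.add (𝒟.smoothNear_nabla hu2 hX)).contMDiffAt

lemma isTwistor_iff_isParallel (hM : IsLeviCivita nablaM) (hn : 3 ≤ Module.finrank ℝ E)
    (σ : Cₛ^∞⟮I; F, S⟯) :
    𝒟.IsTwistor σ ↔ 𝒟.twistorConnection.IsParallel (fun p ↦ (σ p, 𝒟.dirac σ p)) := by
  refine ⟨fun h p x ↦ ?_, fun h p x ↦ ?_⟩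
  · rw [𝒟.isTwistorConnection_twistorConnection]
    refine Prod.ext (h p x) ?_
    simp [𝒟.nabla_dirac_of_isTwistor hM hn h]
  · have := h p x
    rw [𝒟.isTwistorConnection_twistorConnection] at this
    exact congrArg Prod.fst this

end Connection

end DiracBundle

end TwistorConnection

/-! ### Unique continuation and the dimension bound. -/

noncomputable section UniqueContinuation

/-- In a smooth orthonormal frame the coordinates of `s` are bounded by ‖s‖, and the norms of the
images of the frame vectors are continuous, hence below their value at `p` plus 1 nearby. -/
lemma exists_eventually_norm_apply_le
    {E : Type*} [NormedAddCommGroup E] [NormedSpace ℝ E]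
    {H : Type*} [TopologicalSpace H] {I : ModelWithCorners ℝ E H}
    {M : Type*} [TopologicalSpace M] [ChartedSpace H M] [IsManifold I ∞ M]
    {F : Type*} [NormedAddCommGroup F] [NormedSpace ℝ F] [FiniteDimensional ℝ F]
    {S : M → Type*} [TopologicalSpace (TotalSpace F S)]
    [∀ x, NormedAddCommGroup (S x)] [∀ x, InnerProductSpace ℝ (S x)]
    [FiberBundle F S] [VectorBundle ℝ F S] [ContMDiffVectorBundle ∞ F S I]
    [IsContMDiffRiemannianBundle I ∞ F S] {p : M} (A : Π q : M, S q →ₗ[ℝ] S q)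
    (hA : ∀ σ : Π q : M, S q, SmoothNear I F σ p → SmoothNear I F (fun q ↦ A q (σ q)) p) :
    ∃ C : ℝ, ∀ᶠ q in 𝓝 p, ∀ s : S q, ‖A q s‖ ≤ C * ‖s‖ := by
  obtain ⟨e, he, hb⟩ := exists_smoothNear_orthonormal (V := S) I F p
  have hbd (i) : ∀ᶠ q in 𝓝 p, ‖A q (e i q)‖ < √(inner ℝ (A p (e i p)) (A p (e i p))) + 1 := by
    have hc : ContinuousAt (fun q ↦ √(inner ℝ (A q (e i q)) (A q (e i q)))) p :=
      ((hA _ (he i)).inner_bundle (hA _ (he i))).self_of_nhds.continuousAt.sqrt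
    filter_upwards [hc.eventually_lt_const (lt_add_one _)] with q hq
    simpa [real_inner_self_eq_norm_sq] using hq
  refine ⟨∑ i, (√(inner ℝ (A p (e i p)) (A p (e i p))) + 1), ?_⟩
  filter_upwards [hb, Filter.eventually_all.2 hbd] with q ⟨b, hb⟩ hbd s
  calc ‖A q s‖ = ‖∑ i, (inner ℝ (b i) s : ℝ) • A q (e i q)‖ := by
        conv_lhs => rw [← b.sum_repr' s]
        simp [hb]
    _ ≤ ∑ i, ‖(inner ℝ (b i) s : ℝ) • A q (e i q)‖ := norm_sum_le _ _
    _ ≤ ∑ i, (√(inner ℝ (A p (e i p)) (A p (e i p))) + 1) * ‖s‖ := by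
        refine Finset.sum_le_sum fun i _ ↦ ?_
        rw [norm_smul, mul_comm]
        refine mul_le_mul (hbd i).le ?_ (norm_nonneg _) (by positivity)
        simpa using norm_inner_le_norm (𝕜 := ℝ) (b i) s
    _ = _ := by rw [Finset.sum_mul]

variable
  {E : Type*} [NormedAddCommGroup E] [NormedSpace ℝ E] [FiniteDimensional ℝ E]
  {M : Type*} [TopologicalSpace M] [ChartedSpace E M] [IsManifold 𝓘(ℝ, E) ∞ M] {p : M}

/-- A function whose derivatives are bounded near each point by multiples of its absolute value
vanishes near each of its zeros. -/
lemma eventually_eq_zero_of_abs_mvfderiv_le {f : M → ℝ} (hf : MDiff f)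
    (hbound : ∀ X : Π q : M, TangentSpace 𝓘(ℝ, E) q, SmoothNear 𝓘(ℝ, E) E X p →
      ∃ C : ℝ, ∀ᶠ q in 𝓝 p, |mvfderiv 𝓘(ℝ, E) f q (X q)| ≤ C * |f q|)
    (hp : f p = 0) : ∀ᶠ q in 𝓝 p, f q = 0 := by
  let t := trivializationAt E (fun q : M ↦ TangentSpace 𝓘(ℝ, E) q) p
  let b := Module.finBasis ℝ E
  let φ := extChartAt 𝓘(ℝ, E) p
  choose C hC using fun i ↦ hbound _ (.localFrame (p := p) b i)
  have hsrc : φ.source ∈ 𝓝 p := extChartAt_source_mem_nhds p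
  -- The bounds on the frame fields give one for each field with constant coefficients `v` in the
  -- trivialization, on a neighbourhood that does not depend on `v`.
  have hU : ∀ᶠ q in 𝓝 p, q ∈ φ.source ∧ ∀ v : E,
      |mvfderiv 𝓘(ℝ, E) f q (t.symmL ℝ q v)| ≤ (∑ i, |b.repr v i| * C i) * |f q| := by
    filter_upwards [Filter.eventually_all.2 hC, t.open_baseSet.mem_nhds
      (FiberBundle.mem_baseSet_trivializationAt E _ p), hsrc] with q hq hqt hqs
    refine ⟨hqs, fun v ↦ ?_⟩
    have hv : t.symmL ℝ q v = ∑ i, b.repr v i • t.localFrame b i q := by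
      conv_lhs => rw [← b.sum_repr v, map_sum]
      refine Finset.sum_congr rfl fun i _ ↦ ?_
      rw [map_smul]
      simp [Trivialization.basisAt, hqt]
    rw [hv, map_sum, Finset.sum_mul]
    refine (Finset.abs_sum_le_sum_abs _ _).trans (Finset.sum_le_sum fun i _ ↦ ?_)
    rw [map_smul, smul_eq_mul, abs_mul, mul_assoc]
    exact mul_le_mul_of_nonneg_left (hq i) (abs_nonneg _)
  have hφ : ∀ᶠ z in 𝓝 (φ p), z ∈ φ.target ∧ (φ.symm z ∈ φ.source ∧ ∀ v : E,
      |mvfderiv 𝓘(ℝ, E) f (φ.symm z) (t.symmL ℝ (φ.symm z) v)| ≤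
        (∑ i, |b.repr v i| * C i) * |f (φ.symm z)|) := by
    refine Filter.Eventually.and (extChartAt_target_mem_nhds p) ?_
    have hc : Filter.Tendsto φ.symm (𝓝 (φ p)) (𝓝 p) := by
      simpa [ContinuousAt, φ] using continuousAt_extChartAt_symm (I := 𝓘(ℝ, E)) p
    exact hc.eventually hU
  obtain ⟨r, hr, hball⟩ := Metric.eventually_nhds_iff_ball.1 hφ
  filter_upwards [hsrc, (continuousAt_extChartAt p).preimage_mem_nhds
    (Metric.ball_mem_nhds (φ p) hr)] with q hq hqr
  let γ : ℝ → E := AffineMap.lineMap (φ p) (φ q)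
  have hγ (s : ℝ) (hs : s ∈ Set.Icc (0 : ℝ) 1) : γ s ∈ Metric.ball (φ p) r :=
    (convex_ball (φ p) r).lineMap_mem (Metric.mem_ball_self hr) hqr hs
  have hder (s : ℝ) (hs : s ∈ Set.Icc (0 : ℝ) 1) :
      HasDerivAt (fun s ↦ f (φ.symm (γ s)))
        (mvfderiv 𝓘(ℝ, E) f (φ.symm (γ s)) (t.symmL ℝ (φ.symm (γ s)) (φ q - φ p))) s := by
    obtain ⟨hz, hzs, -⟩ := hball _ (hγ s hs)
    have h1 : MDifferentiableAt 𝓘(ℝ, E) 𝓘(ℝ, E) φ.symm (γ s) := by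
      have := mdifferentiableWithinAt_extChartAt_symm (I := 𝓘(ℝ, E)) hz
      rwa [modelWithCornersSelf_coe, Set.range_id, mdifferentiableWithinAt_univ] at this
    have h2 := (hf (φ.symm (γ s))).hasMFDerivAt.comp (γ s) h1.hasMFDerivAt
    have h3 := (hasMFDerivAt_iff_hasFDerivAt.1 h2).comp_hasDerivAt s
      (AffineMap.hasDerivAt_lineMap (a := φ p) (b := φ q) (x := s))
    -- In this trivialization the segment, pulled back to `M`, has constant velocity `φ q - φ p`, so
    -- a single Grönwall constant serves for the whole of it.
    have h4 := TangentBundle.symmL_trivializationAt (𝕜 := ℝ) (I := 𝓘(ℝ, E)) (x₀ := p)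
      (x := φ.symm (γ s)) (by simpa [φ] using hzs)
    rw [φ.right_inv hz] at h4
    simp only [modelWithCornersSelf_coe, Set.range_id, mfderivWithin_univ] at h4
    rw [h4]
    exact h3
  have h0 := eq_zero_of_abs_deriv_le_mul_abs_self_of_eq_zero_right
    (f := fun s ↦ f (φ.symm (γ s))) (a := 0) (b := 1)
    (fun s hs ↦ (hder s hs).continuousAt.continuousWithinAt)
    (fun s hs ↦ (hder s (Set.Ico_subset_Icc_self hs)).hasDerivWithinAt)
    (by simpa [γ, φ] using hp)
    (fun s hs ↦ (hball _ (hγ s (Set.Ico_subset_Icc_self hs))).2.2 _) 1 (by simp)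
  simpa [γ, φ.left_inv hq] using h0

variable
  [RiemannianBundle (fun x : M ↦ TangentSpace 𝓘(ℝ, E) x)]
  [IsContMDiffRiemannianBundle 𝓘(ℝ, E) ∞ E (fun x : M ↦ TangentSpace 𝓘(ℝ, E) x)]
  {F : Type*} [NormedAddCommGroup F] [NormedSpace ℝ F] [FiniteDimensional ℝ F]
  {S : M → Type*} [TopologicalSpace (TotalSpace F S)]
  [∀ x, NormedAddCommGroup (S x)] [∀ x, InnerProductSpace ℝ (S x)]
  [FiberBundle F S] [VectorBundle ℝ F S] [ContMDiffVectorBundle ∞ F S 𝓘(ℝ, E)]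
  [IsContMDiffRiemannianBundle 𝓘(ℝ, E) ∞ F S]
  {nablaM : CovariantDerivative 𝓘(ℝ, E) E (fun x : M ↦ TangentSpace 𝓘(ℝ, E) x)}

namespace DiracBundle

variable (𝒟 : DiracBundle F S nablaM) [T2Space M]

/-- A twistor section on a connected manifold is determined by the values of `σ` and `D σ` at one
point. -/
lemma eq_zero_of_isTwistor [PreconnectedSpace M] (hM : IsLeviCivita nablaM)
    (hn : 3 ≤ Module.finrank ℝ E) {σ : Cₛ^∞⟮𝓘(ℝ, E); F, S⟯} (hσ : 𝒟.IsTwistor σ) {p : M}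
    (h0 : σ p = 0) (h1 : 𝒟.dirac σ p = 0) : σ = 0 := by
  have hs (q : M) : SmoothNear 𝓘(ℝ, E) F σ q := .of_contMDiff σ.contMDiff
  have hD (q : M) := 𝒟.smoothNear_dirac (hs q)
  let f : M → ℝ := fun q ↦ inner ℝ (σ q) (σ q) + inner ℝ (𝒟.dirac σ q) (𝒟.dirac σ q)
  have hfzero (q : M) : f q = 0 ↔ σ q = 0 ∧ 𝒟.dirac σ q = 0 := by
    simp only [f, add_eq_zero_iff_of_nonneg real_inner_self_nonneg real_inner_self_nonneg,
      inner_self_eq_zero]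
  have hm1 (q : M) : MDiffAt (fun q ↦ (inner ℝ (σ q) (σ q) : ℝ)) q :=
    (hs q).mdifferentiableAt.inner_bundle (hs q).mdifferentiableAt
  have hm2 (q : M) : MDiffAt (fun q ↦ (inner ℝ (𝒟.dirac σ q) (𝒟.dirac σ q) : ℝ)) q :=
    (hD q).mdifferentiableAt.inner_bundle (hD q).mdifferentiableAt
  have hf : MDiff f := fun q ↦ (hm1 q).add (hm2 q)
  -- Metric compatibility, with ∇σ and ∇Dσ replaced by zeroth-order terms in (σ, Dσ).
  have hdf (q : M) (X : Π q : M, TangentSpace 𝓘(ℝ, E) q) :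
      mvfderiv 𝓘(ℝ, E) f q (X q) =
        2 * inner ℝ (σ q) (-(1 / (Module.finrank ℝ E : ℝ)) • 𝒟.cmul q (X q) (𝒟.dirac σ q)) +
          2 * inner ℝ (𝒟.dirac σ q) (𝒟.curlyK q (X q) (σ q)) := by
    have e1 := 𝒟.nabla_metric.mvfderiv_inner_eq X (hs q).mdifferentiableAt (hs q).mdifferentiableAt
    have e2 := 𝒟.nabla_metric.mvfderiv_inner_eq X (hD q).mdifferentiableAt (hD q).mdifferentiableAt
    beta_reduce at e1 e2
    have e3 : 𝒟.nabla σ q (X q) =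
        -(1 / (Module.finrank ℝ E : ℝ)) • 𝒟.cmul q (X q) (𝒟.dirac σ q) := by
      rw [neg_smul]; exact eq_neg_of_add_eq_zero_left (hσ q (X q))
    have e4 := mvfderiv_add (hm1 q) (hm2 q)
    change mvfderiv 𝓘(ℝ, E) ((fun q ↦ (inner ℝ (σ q) (σ q) : ℝ)) +
      fun q ↦ (inner ℝ (𝒟.dirac σ q) (𝒟.dirac σ q) : ℝ)) q (X q) = _
    rw [e4, add_apply, e1, e2, 𝒟.nabla_dirac_of_isTwistor hM hn hσ, e3,
      real_inner_comm (σ q), real_inner_comm (𝒟.dirac σ q)]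
    ring
  have hlocal (q : M) (hq : f q = 0) : ∀ᶠ r in 𝓝 q, f r = 0 := by
    refine eventually_eq_zero_of_abs_mvfderiv_le hf (fun X hX ↦ ?_) hq
    obtain ⟨C₁, h₁⟩ := exists_eventually_norm_apply_le (I := 𝓘(ℝ, E)) (F := F) (p := q)
      (fun r ↦ -(1 / (Module.finrank ℝ E : ℝ)) • 𝒟.cmul r (X r))
      fun τ hτ ↦ .const_smul _ (𝒟.smoothNear_cmul hX hτ)
    obtain ⟨C₂, h₂⟩ := exists_eventually_norm_apply_le (I := 𝓘(ℝ, E)) (F := F) (p := q)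
      (fun r ↦ 𝒟.curlyKₗ r (X r)) fun τ hτ ↦ 𝒟.smoothNear_curlyK hX hτ
    refine ⟨|C₁| + |C₂|, ?_⟩
    filter_upwards [h₁, h₂] with r h₁ h₂
    have a1 := (norm_inner_le_norm (𝕜 := ℝ) (σ r)
      (-(1 / (Module.finrank ℝ E : ℝ)) • 𝒟.cmul r (X r) (𝒟.dirac σ r))).trans
      (mul_le_mul_of_nonneg_left (h₁ (𝒟.dirac σ r)) (norm_nonneg _))
    have a2 := (norm_inner_le_norm (𝕜 := ℝ) (𝒟.dirac σ r) (𝒟.curlyK r (X r) (σ r))).trans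
      (mul_le_mul_of_nonneg_left (h₂ (σ r)) (norm_nonneg _))
    have hfr : |f r| = ‖σ r‖ ^ 2 + ‖𝒟.dirac σ r‖ ^ 2 := by
      simp only [f, real_inner_self_eq_norm_sq]
      exact abs_of_nonneg (by positivity)
    -- Both terms of the derivative are bounded by multiples of ‖σ‖‖Dσ‖, and 2ab ≤ a² + b² bounds
    -- that product by f.
    have key (C : ℝ) : 2 * (C * (‖σ r‖ * ‖𝒟.dirac σ r‖)) ≤
        |C| * (‖σ r‖ ^ 2 + ‖𝒟.dirac σ r‖ ^ 2) := by
      have := two_mul_le_add_sq ‖σ r‖ ‖𝒟.dirac σ r‖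
      have h3 : C * (‖σ r‖ * ‖𝒟.dirac σ r‖) ≤ |C| * (‖σ r‖ * ‖𝒟.dirac σ r‖) :=
        mul_le_mul_of_nonneg_right (le_abs_self C) (by positivity)
      have h4 := mul_le_mul_of_nonneg_left this (abs_nonneg C)
      linarith
    rw [hdf, hfr]
    refine (abs_add_le _ _).trans ?_
    rw [abs_mul, abs_mul, abs_two, add_mul]
    rw [Real.norm_eq_abs] at a1 a2
    have k1 := key C₁
    have k2 := key C₂
    refine add_le_add ?_ ?_ <;> nlinarith
  have hclopen : IsClopen {q | f q = 0} :=
    ⟨isClosed_eq hf.continuous continuous_const, isOpen_iff_mem_nhds.2 hlocal⟩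
  have huniv := hclopen.eq_univ ⟨p, (hfzero p).2 ⟨h0, h1⟩⟩
  ext q
  exact ((hfzero q).1 (huniv.ge (Set.mem_univ q))).1

/-- The values of `σ` and `D σ` at `p`, for a twistor section `σ`. -/
def twistorEval (p : M) : 𝒟.twistorSpace →ₗ[ℝ] S p × S p where
  toFun σ := (σ.1 p, 𝒟.dirac σ.1 p)
  map_add' σ τ := by
    have hadd (q : M) : 𝒟.nabla (⇑σ.1 + ⇑τ.1) q = 𝒟.nabla σ.1 q + 𝒟.nabla τ.1 q :=
      𝒟.nabla.isCovariantDerivativeOn.add σ.1.mdifferentiableAt τ.1.mdifferentiableAt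
    refine Prod.ext rfl ?_
    simp [dirac, hadd, Finset.sum_add_distrib]
  map_smul' c σ := by
    have hsmul (q : M) : 𝒟.nabla (c • ⇑σ.1) q = c • 𝒟.nabla σ.1 q :=
      𝒟.nabla.isCovariantDerivativeOn.smul_const c σ.1.mdifferentiableAt
    refine Prod.ext rfl ?_
    simp [dirac, hsmul, Finset.smul_sum]

lemma twistorEval_injective [PreconnectedSpace M] (hM : IsLeviCivita nablaM)
    (hn : 3 ≤ Module.finrank ℝ E) (p : M) : Function.Injective (𝒟.twistorEval p) := by
  refine (injective_iff_map_eq_zero _).2 fun σ hσ ↦ Subtype.ext ?_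
  exact 𝒟.eq_zero_of_isTwistor hM hn σ.2 (congrArg Prod.fst hσ) (congrArg Prod.snd hσ)

lemma finite_twistorSpace [ConnectedSpace M] (hM : IsLeviCivita nablaM)
    (hn : 3 ≤ Module.finrank ℝ E) :
    Module.Finite ℝ 𝒟.twistorSpace ∧
      Module.finrank ℝ 𝒟.twistorSpace ≤ 2 * Module.finrank ℝ F := by
  obtain ⟨p⟩ : Nonempty M := inferInstance
  have : FiniteDimensional ℝ (S p) := VectorBundle.finiteDimensional ℝ F S p
  have hinj := 𝒟.twistorEval_injective hM hn p
  refine ⟨Module.Finite.of_injective _ hinj, ?_⟩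
  refine (LinearMap.finrank_le_finrank_of_injective hinj).trans_eq ?_
  rw [Module.finrank_prod, (VectorBundle.continuousLinearEquivAt ℝ F S p).toLinearEquiv.finrank_eq,
    two_mul]

end DiracBundle

end UniqueContinuation

theorem mainTheorem5
    {E : Type*} [NormedAddCommGroup E] [NormedSpace ℝ E] [FiniteDimensional ℝ E]
    {M : Type*} [TopologicalSpace M] [T2Space M] [ChartedSpace E M] [IsManifold 𝓘(ℝ, E) ∞ M]
    [RiemannianBundle (fun x : M ↦ TangentSpace 𝓘(ℝ, E) x)]
    [IsContMDiffRiemannianBundle 𝓘(ℝ, E) ∞ E (fun x : M ↦ TangentSpace 𝓘(ℝ, E) x)]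
    (nablaM : CovariantDerivative 𝓘(ℝ, E) E (fun x : M ↦ TangentSpace 𝓘(ℝ, E) x))
    (hnablaM : IsLeviCivita nablaM)
    {F : Type*} [NormedAddCommGroup F] [NormedSpace ℝ F] [FiniteDimensional ℝ F]
    {S : M → Type*} [TopologicalSpace (TotalSpace F S)]
    [∀ x, NormedAddCommGroup (S x)] [∀ x, InnerProductSpace ℝ (S x)]
    [FiberBundle F S] [VectorBundle ℝ F S] [ContMDiffVectorBundle ∞ F S 𝓘(ℝ, E)]
    [IsContMDiffRiemannianBundle 𝓘(ℝ, E) ∞ F S]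
    (𝒟 : DiracBundle F S nablaM)
    (hn : 3 ≤ Module.finrank ℝ E) :
    (∃ nablaE : CovariantDerivative 𝓘(ℝ, E) (F × F) (S ×ᵇ S),
      CovariantDerivative.ContMDiffCovariantDerivative nablaE ∞ ∧
      𝒟.IsTwistorConnection nablaE ∧
      ∀ σ : Cₛ^∞⟮𝓘(ℝ, E); F, S⟯,
        𝒟.IsTwistor σ ↔ nablaE.IsParallel (fun p ↦ (σ p, 𝒟.dirac σ p))) ∧
    (ConnectedSpace M →
      Module.Finite ℝ 𝒟.twistorSpace ∧
      Module.finrank ℝ 𝒟.twistorSpace ≤ 2 * Module.finrank ℝ F) :=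
  ⟨⟨𝒟.twistorConnection, 𝒟.contMDiff_twistorConnection, 𝒟.isTwistorConnection_twistorConnection,
      𝒟.isTwistor_iff_isParallel hnablaM hn⟩,
    fun _ ↦ 𝒟.finite_twistorSpace hnablaM hn⟩
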